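/- **Data.** Let $b,\sigma:[0,\infty[\,\to\mathbb R$ be locally Lipschitz with $\sigma>0$ on $]0,\infty[$. Put $$p'(x)=\exp\Bigl(-2\int_1^x \frac{b(s)}{\sigma^2(s)}\,ds\Bigr),\qquad p(1)=0,\qquad m(dx)=\frac{2}{\sigma^2(x)p'(x)}\,dx ,$$ the scale function and speed measure of $dX=b(X)\,dt+\sigma(X)\,dW$ on $]0,\infty[$. Assume that $0$ is inaccessible, i.e. $\int_0^1 m(]y,1])\,p'(y)\,dy=\infty$, and that $\infty$ is natural, i.e. $\int_1^\infty m(]1,y])\,p'(y)\,dy=\infty$ and $\int_1^\infty (p(y)-p(1))\,m(dy)=\infty$. Let $r:[0,\infty[\,\to\mathbb R$ be bounded and continuous with $r\ge r_0$ for some constant $r_0>0$. Let $$\mathscr L w=\tfrac12\sigma^2w''+bw'-rw ,$$ and let $\varphi,\psi\in C^2(]0,\infty[)$ be the fundamental solutions of $\mathscr L w=0$ such that $\varphi>0$, $\varphi'<0$, $\psi>0$, $\psi'>0$ on $]0,\infty[$ and $\lim_{x\downarrow0}\varphi(x)=\lim_{x\uparrow\infty}\psi(x)=\infty$ (unique up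 to positive multiplicative constants). Put $$C=\varphi(1)\psi'(1)-\varphi'(1)\psi(1),\qquad \Psi=\frac{2\psi}{C\sigma^2p'},\qquad \Phi=\frac{2\varphi}{C\sigma^2p'} .$$ A function $f:\,]0,\infty[\,\to\mathbb R$ is called *admissible* if $\int_0^x|f|\Psi\,ds+\int_x^\infty|f|\Phi\,ds<\infty$ for all $x>0$, and then $$R_f(x)=\varphi(x)\int_0^xf\,\Psi\,ds+\psi(x)\int_x^\infty f\,\Phi\,ds .$$ Let $h,k:\,]0,\infty[\,\to\mathbb R$ be as follows. The function $h$ is continuous, bounded from below and admissible, and $\lim_{x\downarrow0}h(x)/r(x)$ exists in $\mathbb R$. The function $k$ is locally absolutely continuous, $\int_0^1|k|\,ds<\infty$, the function $K(x)=\int_0^xk(s)\,ds$ is bounded from below, $\mathscr L K$ is admissible, and $\limsup_{x\uparrow\infty}K(x)/\psi(x)\in[0,\infty[$. The function $\Theta=h+\mathscr L K$ is continuous on $]0,\infty[$, and there is $\xi\in\,]0,\infty[$ such that $\Theta/r$ is strictly increasing on $]0,\xi[$ and strictly decreasing on $]\xi,\infty[$. Put $$g=\frac{R_\Theta'}{\psi'},\qquad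 G_\Theta=R_\Theta-\frac{R_\Theta'}{\psi'}\,\psi,\qquad F(\gamma,\beta)=G_\Theta(\beta)-G_\Theta(\gamma).$$ **Statement.** There is a unique $\underline x\in\,]\xi,\infty]$ such that $g'(x)<0$ for all $x\in\,]0,\underline x[$ and $g'(x)>0$ for all $x\in\,]\underline x,\infty[$. Suppose that $\underline x<\infty$. Then the limits $g_0=\lim_{x\downarrow0}g(x)$ and $\lim_{x\uparrow\infty}\Theta(x)/r(x)$ exist in $[-\infty,\infty]$. Let $\overline x=\inf\{s>0: g(s)>g_0\}$, with $\inf\emptyset=\infty$. For each $\beta\in\,]\underline x,\overline x[$ there is $\Gamma(\beta)\in\,]0,\underline x[$ with $g(\Gamma(\beta))=g(\beta)$, and the limit $$c^\star:=-\lim_{\beta\uparrow\overline x}F(\Gamma(\beta),\beta)$$ exists in $]0,\infty]$. Moreover: 1. There exist a unique strictly decreasing function $\gamma^\star:\,]0,c^\star[\,\to\,]0,\underline x[$ and a unique strictly increasing function $\beta^\star:\,]0,c^\star[\,\to\,]\underline x,\overline x[$ such that, for all $c\in\,]0,c^\star[$, $$g(x)-g(\beta^\star(c))\ \begin{cases}>0,&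 x\in\,]0,\gamma^\star(c)[,\\ =0,& x=\gamma^\star(c),\\ <0,& x\in\,]\gamma^\star(c),\beta^\star(c)[,\end{cases}\qquad\text{and}\qquad F(\gamma^\star(c),\beta^\star(c))=-c .$$ 2. There are no other solutions: if $c>0$ and $0<\gamma<\beta<\infty$ satisfy $g(\gamma)=g(\beta)$ and $F(\gamma,\beta)=-c$, then $c<c^\star$, $\gamma=\gamma^\star(c)$ and $\beta=\beta^\star(c)$. 3. $\lim_{c\downarrow0}\beta^\star(c)=\lim_{c\downarrow0}\gamma^\star(c)=\underline x$ and $\lim_{c\uparrow c^\star}\beta^\star(c)=\overline x$. The limit $\lim_{c\uparrow c^\star}\gamma^\star(c)$ exists in $\mathbb R$; it is $>0$ if $g_0>0$ (in which case $\overline x=\infty$), it is $0$ if $g_0=0$ (in which case $\overline x=\infty$), and it is $0$ if $g_0<0$ (in which case $\overline x<\infty$). 4. $c^\star<\infty$ if and only if either $\overline x<\infty$, or $\overline x=\infty$ and $\lim_{x\uparrow\infty}\Theta(x)/r(x)>-\infty$. -/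

import Mathlib

open Set Filter Topology MeasureTheory

noncomputable section

namespace ImpulseControl

/-- The data of the problem: drift `b` and volatility `σ` of the uncontrolled diffusion
`dX = b(X) dt + σ(X) dW` in `]0,∞[`, discounting rate `r`, running payoff `h`, marginal payoff `k`.
Functions are given on `ℝ`; only their values on `[0,∞[` (for `b`, `σ`, `r`) and on
`]0,∞[` (for `h`, `k`) are ever used. -/
structure Data where
  b : ℝ → ℝ
  σ : ℝ → ℝ
  r : ℝ → ℝ
  h : ℝ → ℝ
  k : ℝ → ℝ

namespace Data

variable (D : Data)

/-- The derivative `p'` of the scale function. -/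
def scaleDeriv (x : ℝ) : ℝ :=
  Real.exp (-2 * ∫ s in (1 : ℝ)..x, D.b s / (D.σ s) ^ 2)

/-- The scale function `p`, normalised by `p(1) = 0`. -/
def scale (x : ℝ) : ℝ := ∫ s in (1 : ℝ)..x, D.scaleDeriv s

/-- The speed measure `m(dx) = 2 / (σ²(x) p'(x)) dx` on `]0,∞[`. -/
def speed : Measure ℝ :=
  (volume.restrict (Ioi 0)).withDensity
    (fun x => ENNReal.ofReal (2 / ((D.σ x) ^ 2 * D.scaleDeriv x)))

/-- The boundary point `0` is inaccessible (Feller's test):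
`∫_0^1 m(]y,1]) p'(y) dy = ∞`. -/
def ZeroInaccessible : Prop :=
  ∫⁻ y in Ioc (0 : ℝ) 1, D.speed (Ioc y 1) * ENNReal.ofReal (D.scaleDeriv y) = ⊤

/-- The boundary point `∞` is natural, that is, neither exit nor entrance:
`∫_1^∞ m(]1,y]) p'(y) dy = ∞` and `∫_1^∞ (p(y) - p(1)) m(dy) = ∞`. -/
def InftyNatural : Prop :=
  (∫⁻ y in Ioi (1 : ℝ), D.speed (Ioc 1 y) * ENNReal.ofReal (D.scaleDeriv y) = ⊤) ∧
  (∫⁻ y in Ioi (1 : ℝ), ENNReal.ofReal (D.scale y - D.scale 1) ∂D.speed = ⊤)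

/-- The operator `ℒ w = ½ σ² w'' + b w' - r w`. -/
def op (w : ℝ → ℝ) (x : ℝ) : ℝ :=
  (1 / 2) * (D.σ x) ^ 2 * deriv (deriv w) x + D.b x * deriv w x - D.r x * w x

/-- The function `x ↦ ∫_0^x k(s) ds`. -/
def intK (x : ℝ) : ℝ := ∫ s in (0 : ℝ)..x, D.k s

/-- `Θ = h + ℒ (∫_0^· k(s) ds)`. -/
def Theta (x : ℝ) : ℝ := D.h x + D.op D.intK x

/-- `φ` and `ψ` are the decreasing and the increasing fundamental solutions of `ℒ w = 0`
(each is determined up to a positive multiplicative constant). -/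
structure IsFundamental (φ ψ : ℝ → ℝ) : Prop where
  φ_smooth : ContDiffOn ℝ 2 φ (Ioi 0)
  ψ_smooth : ContDiffOn ℝ 2 ψ (Ioi 0)
  φ_ode : ∀ x, 0 < x → D.op φ x = 0
  ψ_ode : ∀ x, 0 < x → D.op ψ x = 0
  φ_pos : ∀ x, 0 < x → 0 < φ x
  φ_deriv : ∀ x, 0 < x → deriv φ x < 0
  ψ_pos : ∀ x, 0 < x → 0 < ψ x
  ψ_deriv : ∀ x, 0 < x → 0 < deriv ψ x
  φ_zero : Tendsto φ (𝓝[>] 0) atTop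
  ψ_infty : Tendsto ψ atTop atTop

section Resolvent

variable (φ ψ : ℝ → ℝ)

/-- The Wronskian constant `C = φ(1) ψ'(1) - φ'(1) ψ(1)`. -/
def wronskian : ℝ := φ 1 * deriv ψ 1 - deriv φ 1 * ψ 1

/-- `Ψ = 2 ψ / (C σ² p')`. -/
def capPsi (x : ℝ) : ℝ := 2 * ψ x / (wronskian φ ψ * (D.σ x) ^ 2 * D.scaleDeriv x)

/-- `Φ = 2 φ / (C σ² p')`. -/
def capPhi (x : ℝ) : ℝ := 2 * φ x / (wronskian φ ψ * (D.σ x) ^ 2 * D.scaleDeriv x)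

/-- The integrability condition
`∫_0^x |F| Ψ ds + ∫_x^∞ |F| Φ ds < ∞` for all `x > 0`. -/
def ResolventIntegrable (F : ℝ → ℝ) : Prop :=
  ∀ x, 0 < x → IntegrableOn (fun s => F s * D.capPsi φ ψ s) (Ioc 0 x) ∧
    IntegrableOn (fun s => F s * D.capPhi φ ψ s) (Ioi x)

/-- `R_F(x) = φ(x) ∫_0^x F Ψ ds + ψ(x) ∫_x^∞ F Φ ds`. -/
def resolvent (F : ℝ → ℝ) (x : ℝ) : ℝ :=
  φ x * (∫ s in (0 : ℝ)..x, F s * D.capPsi φ ψ s) +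
    ψ x * ∫ s in Ioi x, F s * D.capPhi φ ψ s

/-- The quotient `R'_Θ / ψ'`. -/
def ratio (x : ℝ) : ℝ := deriv (D.resolvent φ ψ D.Theta) x / deriv ψ x

/-- `G_Θ = R_Θ - (R'_Θ / ψ') ψ`. -/
def G (x : ℝ) : ℝ := D.resolvent φ ψ D.Theta x - D.ratio φ ψ x * ψ x

/-- `F(γ, β) = G_Θ(β) - G_Θ(γ)`. -/
def bigF (γ β : ℝ) : ℝ := D.G φ ψ β - D.G φ ψ γ

/-- The free-boundary system for `(γ, β)` with fixed cost `c`. -/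
def FreeBoundarySystem (c γ β : ℝ) : Prop :=
  D.ratio φ ψ γ = D.ratio φ ψ β ∧ D.bigF φ ψ γ β = -c

end Resolvent

/-- The standing assumptions of the control problem. -/
structure StandingAssumptions (φ ψ : ℝ → ℝ) (ξ : ℝ) : Prop where
  b_lip : LocallyLipschitzOn (Ici 0) D.b
  σ_lip : LocallyLipschitzOn (Ici 0) D.σ
  σ_pos : ∀ x, 0 < x → 0 < D.σ x
  zero_inaccessible : D.ZeroInaccessible
  infty_natural : D.InftyNatural
  r_cont : ContinuousOn D.r (Ici 0)
  r_bdd : ∃ M, ∀ x, 0 ≤ x → D.r x ≤ M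
  r_pos : ∃ r₀ > 0, ∀ x, 0 ≤ x → r₀ ≤ D.r x
  fundamental : D.IsFundamental φ ψ
  h_cont : ContinuousOn D.h (Ioi 0)
  h_bdd_below : ∃ M, ∀ x, 0 < x → M ≤ D.h x
  h_lim : ∃ l : ℝ, Tendsto (fun x => D.h x / D.r x) (𝓝[>] 0) (𝓝 l)
  h_int : D.ResolventIntegrable φ ψ D.h
  k_ac : ∀ x y, 0 < x → x ≤ y → AbsolutelyContinuousOnInterval D.k x y
  k_int : IntegrableOn D.k (Ioc 0 1)
  k_bdd_below : ∃ M, ∀ x, 0 < x → M ≤ D.intK x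
  Lk_int : D.ResolventIntegrable φ ψ (D.op D.intK)
  k_growth : ∃ l : ℝ, 0 ≤ l ∧
    limsup (fun x => ((D.intK x / ψ x : ℝ) : EReal)) atTop = (l : EReal)
  Θ_cont : ContinuousOn D.Theta (Ioi 0)
  ξ_pos : 0 < ξ
  Θ_incr : StrictMonoOn (fun x => D.Theta x / D.r x) (Ioo 0 ξ)
  Θ_decr : StrictAntiOn (fun x => D.Theta x / D.r x) (Ioi ξ)

section Points

variable (φ ψ : ℝ → ℝ)

/-- `xl` is the point `x̲ ∈ ]ξ,∞]` at which `(R'_Θ/ψ')'` turns from negative to positive. -/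
def IsLowerPoint (ξ : ℝ) (xl : EReal) : Prop :=
  (ξ : EReal) < xl ∧
  ∀ x : ℝ, 0 < x →
    (((x : EReal) < xl → deriv (D.ratio φ ψ) x < 0) ∧
     (xl < (x : EReal) → 0 < deriv (D.ratio φ ψ) x))

/-- The point `x̄ = inf {s > 0 | R'_Θ(s)/ψ'(s) > g₀}` (with `inf ∅ = ∞`), where
`g₀ = lim_{x ↓ 0} R'_Θ(x)/ψ'(x)`. -/
def upperPoint (g₀ : EReal) : EReal :=
  sInf {y : EReal | ∃ s : ℝ, 0 < s ∧ g₀ < (D.ratio φ ψ s : EReal) ∧ y = (s : EReal)}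

end Points

end Data

/-- The filter of real numbers increasing to `a ∈ ]-∞,∞]` from strictly below;
this is `atTop` if `a = ∞`. -/
def upTo (a : EReal) : Filter ℝ := comap (fun x : ℝ => (x : EReal)) (𝓝[<] a)

namespace Data

variable (D : Data) (φ ψ : ℝ → ℝ)

/-- `cs = c* = - lim_{β ↑ x̄} F(Γ(β), β)`, where `Γ(β)`, for `β ∈ ]x̲, x̄[`, is the point of
`]0, x̲[` at which `R'_Θ/ψ'` takes the same value as at `β`. -/
def IsCriticalCost (xl : ℝ) (xu cs : EReal) : Prop :=
  ∃ Γ : ℝ → ℝ,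
    (∀ β : ℝ, xl < β → (β : EReal) < xu →
      Γ β ∈ Ioo 0 xl ∧ D.ratio φ ψ (Γ β) = D.ratio φ ψ β) ∧
    Tendsto (fun β => ((-D.bigF φ ψ (Γ β) β : ℝ) : EReal)) (upTo xu) (𝓝 cs)

/-- The interval `]0, cs[` of real numbers, for `cs ∈ ]0,∞]`. -/
def costs (cs : EReal) : Set ℝ := {c : ℝ | 0 < c ∧ (c : EReal) < cs}

/-- `γ` and `β` are free-boundary functions on `]0, cs[`: `γ` is strictly decreasing with values
in `]0, x̲[`, `β` is strictly increasing with values in `]x̲, x̄[`, and `(γ(c), β(c))` solves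
the free-boundary problem with cost `c`, with the stated signs. -/
structure IsFreeBoundary (xl : ℝ) (xu cs : EReal) (γ β : ℝ → ℝ) : Prop where
  γ_anti : StrictAntiOn γ (costs cs)
  β_mono : StrictMonoOn β (costs cs)
  γ_mem : ∀ c ∈ costs cs, γ c ∈ Ioo 0 xl
  β_mem : ∀ c ∈ costs cs, xl < β c ∧ (β c : EReal) < xu
  sign_pos : ∀ c ∈ costs cs, ∀ x ∈ Ioo 0 (γ c), 0 < D.ratio φ ψ x - D.ratio φ ψ (β c)
  sign_zero : ∀ c ∈ costs cs, D.ratio φ ψ (γ c) - D.ratio φ ψ (β c) = 0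
  sign_neg : ∀ c ∈ costs cs, ∀ x ∈ Ioo (γ c) (β c), D.ratio φ ψ x - D.ratio φ ψ (β c) < 0
  cost : ∀ c ∈ costs cs, D.bigF φ ψ (γ c) (β c) = -c

end Data

end ImpulseControl

end

/-! Write `θ = Θ/r`. The fluxes `ψ'/(Cp')` and `-φ'/(Cp')` equal `∫_0^x rΨ` and `∫_x^∞ rΦ`: the
equation in divergence form gives their derivatives, and the boundary conditions at `0` and `∞` make
them vanish there (`fluxPsi_tendsto`, `fluxPhi_tendsto`). Hence `g'` is a positive factor times
`slope x = ∫_0^x (θ(s) - θ(x)) rΨ ds` (`hasDerivAt_ratio`), which is negative on `]0,ξ]`, where `θ`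
increases, and strictly increasing beyond `ξ`, where `θ` decreases. So `g'` changes sign at most
once, after `ξ`.

Suppose it does, at a finite `xl`. Then `g` is a valley with bottom `xl`, it tends to `0` at
infinity because `R_Θ/ψ → 0`, and `dG = -ψ dg`. For points `Γ(β) < xl < β` on the same level, the
loss `G(Γ(β)) - G(β) = ∫ ψ dg` over `[Γ(β), β]` can be sliced by levels: each level `v` contributes
the difference of `ψ` between its right and left points, times `dv`. As `ψ` is increasing, the loss
is positive, continuous and strictly increasing in `β`, with limit `0` at `xl`. Its inverse is the
right free boundary, the partner on the same level is the left one, `c*` is the supremum of the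
losses, and any solution with `γ < β` must straddle `xl` and so is one of these pairs.

The limits at `c*` only depend on how `g₀` compares with `0`, the level of `g` at infinity. If `x̄ <
∞`, the loss is bounded by `ψ` times the height of the valley. If `x̄ = ∞`, letting `β → ∞` shows
that the loss is bounded exactly when `R_Θ = G + gψ` is bounded below (`criticalCost_lt_top_iff`),
and since `φ → 0` at infinity this happens exactly when `θ` does not tend to `-∞`
(`resolvent_bddBelow_iff`). -/

namespace ImpulseControl

/-! ### Valleys and the loss along level pairs -/

/-- A function `g` on `]0,∞[` that decreases strictly up to `xl`, increases strictly afterwards and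
vanishes at infinity, with a function `G` behaving like `-∫ ψ dg`. -/
structure Valley (g G ψ : ℝ → ℝ) (xl : ℝ) : Prop where
  pos : 0 < xl
  cont : ContinuousOn g (Ioi 0)
  anti : StrictAntiOn g (Ioc 0 xl)
  mono : StrictMonoOn g (Ici xl)
  lim : Tendsto g atTop (𝓝 0)
  weight_mono : StrictMonoOn ψ (Ioi 0)
  right_lower : ∀ x y, xl ≤ x → x ≤ y → ψ x * (g y - g x) ≤ G x - G y
  right_upper : ∀ x y, xl ≤ x → x ≤ y → G x - G y ≤ ψ y * (g y - g x)
  left_lower : ∀ x y, 0 < x → x ≤ y → y ≤ xl → G x ≤ G y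
  left_upper : ∀ x y, 0 < x → x ≤ y → y ≤ xl → G y - G x ≤ ψ y * (g x - g y)

/-- The infimum of the points at which `g` exceeds `g₀`. -/
noncomputable def exceedPoint (g : ℝ → ℝ) (g₀ : EReal) : EReal :=
  sInf {y : EReal | ∃ s : ℝ, 0 < s ∧ g₀ < (g s : EReal) ∧ y = (s : EReal)}

/-- A point of `]0, xl[` at which `g` takes the same value as at `β`. -/
noncomputable def leftPoint (g : ℝ → ℝ) (xl β : ℝ) : ℝ :=
  Classical.epsilon fun γ => γ ∈ Ioo 0 xl ∧ g γ = g β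

/-- The loss `G(Γ(β)) - G(β)`. -/
noncomputable def excess (g G : ℝ → ℝ) (xl β : ℝ) : ℝ := G (leftPoint g xl β) - G β

/-- The interval `]xl, xu[` of real numbers. -/
def rightInterval (xl : ℝ) (xu : EReal) : Set ℝ := {β | xl < β ∧ (β : EReal) < xu}

/-- The supremum of the attainable losses. -/
noncomputable def criticalCost (g G : ℝ → ℝ) (xl : ℝ) (xu : EReal) : EReal :=
  sSup ((fun β => (excess g G xl β : EReal)) '' rightInterval xl xu)

theorem eventually_upTo {a u : EReal} (h : a < u) :
    ∀ᶠ x : ℝ in upTo u, a < (x : EReal) ∧ (x : EReal) < u :=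
  preimage_mem_comap (Ioo_mem_nhdsLT h)

namespace Valley

variable {g G ψ : ℝ → ℝ} {xl : ℝ} {g₀ : EReal}

theorem min_le (V : Valley g G ψ xl) {x : ℝ} (hx : 0 < x) : g xl ≤ g x := by
  rcases le_total x xl with h | h
  · exact V.anti.antitoneOn ⟨hx, h⟩ ⟨V.pos, le_rfl⟩ h
  · exact V.mono.monotoneOn self_mem_Ici h h

theorem neg (V : Valley g G ψ xl) {x : ℝ} (hx : xl ≤ x) : g x < 0 := by
  have h1 : g x < g (x + 1) := V.mono hx (mem_Ici.2 (by linarith)) (by linarith)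
  have h2 : g (x + 1) ≤ 0 := ge_of_tendsto V.lim <| by
    filter_upwards [eventually_ge_atTop (x + 1)] with y hy
    exact V.mono.monotoneOn (mem_Ici.2 (by linarith)) (mem_Ici.2 (by linarith)) hy
  linarith

theorem exists_lim_zero (V : Valley g G ψ xl) :
    ∃ g₀ : EReal, Tendsto (fun x => (g x : EReal)) (𝓝[>] (0 : ℝ)) (𝓝 g₀) := by
  refine ⟨sSup ((fun x => (g x : EReal)) '' Ioc 0 xl), tendsto_order.2 ⟨fun a ha => ?_, fun a ha => ?_⟩⟩
  · obtain ⟨_, ⟨x, hx, rfl⟩, hax⟩ := lt_sSup_iff.1 ha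
    filter_upwards [Ioo_mem_nhdsGT hx.1] with y hy
    exact hax.trans (EReal.coe_lt_coe_iff.2 (V.anti ⟨hy.1, hy.2.le.trans hx.2⟩ hx hy.2))
  · filter_upwards [Ioc_mem_nhdsGT V.pos] with y hy
    exact (le_sSup (mem_image_of_mem _ hy)).trans_lt ha

variable (V : Valley g G ψ xl) (hg : Tendsto (fun x => (g x : EReal)) (𝓝[>] (0 : ℝ)) (𝓝 g₀))

include V hg

theorem lt_lim_zero {x : ℝ} (hx : x ∈ Ioc 0 xl) : (g x : EReal) < g₀ := by
  have hx2 : x / 2 ∈ Ioc 0 xl := ⟨by linarith [hx.1], by linarith [hx.1, hx.2]⟩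
  refine (EReal.coe_lt_coe_iff.2 (V.anti hx2 hx (by linarith [hx.1]))).trans_le ?_
  refine ge_of_tendsto hg ?_
  filter_upwards [Ioc_mem_nhdsGT hx2.1] with y hy
  exact EReal.coe_le_coe_iff.2 (V.anti.antitoneOn ⟨hy.1, hy.2.trans hx2.2⟩ hx2 hy.2)

theorem exists_left {v : ℝ} (h1 : g xl < v) (h2 : (v : EReal) < g₀) : ∃ γ ∈ Ioo 0 xl, g γ = v := by
  obtain ⟨a, ha, hav⟩ : ∃ a ∈ Ioc 0 xl, v < g a := by
    obtain ⟨a, ha⟩ := ((hg.eventually (lt_mem_nhds h2)).and (Ioc_mem_nhdsGT V.pos)).exists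
    exact ⟨a, ha.2, EReal.coe_lt_coe_iff.1 ha.1⟩
  obtain ⟨x, hx, rfl⟩ := intermediate_value_Icc' ha.2
    (V.cont.mono fun x hx => ha.1.trans_le hx.1) ⟨h1.le, hav.le⟩
  refine ⟨x, ⟨ha.1.trans_le hx.1, lt_of_le_of_ne hx.2 ?_⟩, rfl⟩
  rintro rfl
  exact h1.false

omit hg in
theorem exists_right {v : ℝ} (h1 : g xl < v) (h2 : v < 0) : ∃ β, xl < β ∧ g β = v := by
  obtain ⟨b, hbv, hb⟩ := ((V.lim.eventually (lt_mem_nhds h2)).and (eventually_ge_atTop xl)).exists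
  obtain ⟨x, hx, rfl⟩ := intermediate_value_Icc hb
    (V.cont.mono fun x hx => V.pos.trans_le hx.1) ⟨h1.le, hbv.le⟩
  refine ⟨x, lt_of_le_of_ne hx.1 ?_, rfl⟩
  rintro rfl
  exact h1.false

/-- On the right branch `g` is increasing, so the infimum defining `x̄` becomes a condition on
levels. Points of the left branch never count, since `g` stays below its limit `g₀` there. -/
theorem lt_exceedPoint_iff {β : ℝ} (hβ : xl ≤ β) :
    (β : EReal) < exceedPoint g g₀ ↔ (g β : EReal) < g₀ := by
  have hβ0 := V.pos.trans_le hβ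
  constructor
  · intro h
    obtain ⟨c, hc1, hc2⟩ := EReal.lt_iff_exists_real_btwn.1 h
    have hc1 := EReal.coe_lt_coe_iff.1 hc1
    have : (g c : EReal) ≤ g₀ := by
      by_contra! hlt
      exact hc2.not_ge (sInf_le ⟨c, by linarith, hlt, rfl⟩)
    exact (EReal.coe_lt_coe_iff.2 (V.mono hβ (hβ.trans hc1.le) hc1)).trans_le this
  · intro h
    obtain ⟨v, hv1, hv2⟩ := EReal.lt_iff_exists_real_btwn.1 h
    -- Continuity leaves room for some `c > β` whose level is still below `g₀`; no point up to `c`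
    -- exceeds `g₀`, so the infimum is at least `c`.
    have hc : Tendsto g (𝓝[>] β) (𝓝 (g β)) :=
      ((V.cont.continuousAt (Ioi_mem_nhds hβ0)).tendsto).mono_left nhdsWithin_le_nhds
    obtain ⟨c, hcv, hc⟩ := ((hc.eventually (gt_mem_nhds (EReal.coe_lt_coe_iff.1 hv1))).and
      self_mem_nhdsWithin).exists
    refine (EReal.coe_lt_coe_iff.2 hc).trans_le (le_sInf ?_)
    rintro _ ⟨s, hs, hgs, rfl⟩
    rw [EReal.coe_le_coe_iff]
    by_contra! hsc
    refine hgs.not_ge ?_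
    rcases le_total s xl with h' | h'
    · exact (V.lt_lim_zero hg ⟨hs, h'⟩).le
    · exact ((EReal.coe_lt_coe_iff.2 ((V.mono h' (hβ.trans hc.le) hsc).trans hcv)).trans hv2).le

theorem lower_lt_exceedPoint : (xl : EReal) < exceedPoint g g₀ :=
  (V.lt_exceedPoint_iff hg le_rfl).2 (V.lt_lim_zero hg ⟨V.pos, le_rfl⟩)

theorem exceedPoint_eq_top (h : 0 ≤ g₀) : exceedPoint g g₀ = ⊤ := by
  rw [EReal.eq_top_iff_forall_lt]
  intro y
  refine (EReal.coe_le_coe_iff.2 (le_max_left y xl)).trans_lt ?_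
  rw [V.lt_exceedPoint_iff hg (le_max_right _ _)]
  exact (EReal.coe_lt_coe_iff.2 (V.neg (le_max_right y xl))).trans_le h

theorem exceedPoint_lt_top (h : g₀ < 0) : exceedPoint g g₀ < ⊤ := by
  obtain ⟨v, hv1, hv2⟩ := EReal.lt_iff_exists_real_btwn.1 h
  have hv2 : v < 0 := EReal.coe_lt_coe_iff.1 hv2
  have hlt := EReal.coe_lt_coe_iff.1 ((V.lt_lim_zero hg ⟨V.pos, le_rfl⟩).trans hv1)
  obtain ⟨β, hβ, rfl⟩ := V.exists_right hlt hv2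
  exact lt_of_not_ge fun h' => by
    have := (V.lt_exceedPoint_iff hg hβ.le).1 ((EReal.coe_lt_top β).trans_le h')
    exact this.not_gt hv1

theorem exists_mem_rightInterval {v : ℝ} (h1 : g xl < v) (h2 : (v : EReal) < g₀) (h3 : v < 0) :
    ∃ β ∈ rightInterval xl (exceedPoint g g₀), g β = v := by
  obtain ⟨β, hβ, rfl⟩ := V.exists_right h1 h3
  exact ⟨β, ⟨hβ, (V.lt_exceedPoint_iff hg hβ.le).2 h2⟩, rfl⟩

theorem leftPoint_spec {β : ℝ} (hβ : β ∈ rightInterval xl (exceedPoint g g₀)) :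
    leftPoint g xl β ∈ Ioo 0 xl ∧ g (leftPoint g xl β) = g β := by
  obtain ⟨γ, hγ⟩ := V.exists_left hg (V.mono self_mem_Ici hβ.1.le hβ.1)
    ((V.lt_exceedPoint_iff hg hβ.1.le).1 hβ.2)
  exact Classical.epsilon_spec (p := fun γ => γ ∈ Ioo 0 xl ∧ g γ = g β) ⟨γ, hγ⟩

theorem eq_leftPoint {β γ : ℝ} (hβ : β ∈ rightInterval xl (exceedPoint g g₀))
    (hγ : γ ∈ Ioo 0 xl) (h : g γ = g β) : γ = leftPoint g xl β := by
  have := V.leftPoint_spec hg hβ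
  exact V.anti.injOn (Ioo_subset_Ioc_self hγ) (Ioo_subset_Ioc_self this.1) (h.trans this.2.symm)

theorem leftPoint_anti {β β' : ℝ} (hβ : β ∈ rightInterval xl (exceedPoint g g₀))
    (hβ' : β' ∈ rightInterval xl (exceedPoint g g₀)) (h : β < β') :
    leftPoint g xl β' < leftPoint g xl β := by
  have h1 := V.leftPoint_spec hg hβ
  have h2 := V.leftPoint_spec hg hβ'
  rw [← V.anti.lt_iff_gt (Ioo_subset_Ioc_self h1.1) (Ioo_subset_Ioc_self h2.1), h1.2, h2.2]
  exact V.mono hβ.1.le hβ'.1.le h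

/-- Raising the level from `g β` to `g β'` gains at least `ψ β * (g β' - g β)` on the right branch
and costs at most `ψ (Γ(β)) * (g β' - g β)` on the left one, and `ψ (Γ(β)) < ψ β`. -/
theorem excess_strictMono : StrictMonoOn (excess g G xl) (rightInterval xl (exceedPoint g g₀)) := by
  intro β hβ β' hβ' h
  have h1 := V.leftPoint_spec hg hβ
  have h2 := V.leftPoint_spec hg hβ'
  have hψ : ψ (leftPoint g xl β) < ψ β :=
    V.weight_mono h1.1.1 (V.pos.trans hβ.1) (h1.1.2.trans hβ.1)
  have hgg := V.mono hβ.1.le hβ'.1.le h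
  have i1 := V.right_lower β β' hβ.1.le h.le
  have i2 := V.left_upper _ _ h2.1.1 (V.leftPoint_anti hg hβ hβ' h).le h1.1.2.le
  rw [h1.2, h2.2] at i2
  unfold excess
  nlinarith [mul_pos (sub_pos.2 hψ) (sub_pos.2 hgg)]

/-- The left branch only reduces the loss, so it is dropped. The resulting bound by increments of
`g` gives continuity of the loss without any continuity of `leftPoint`. -/
theorem excess_sub_le {β β' : ℝ} (hβ : β ∈ rightInterval xl (exceedPoint g g₀))
    (hβ' : β' ∈ rightInterval xl (exceedPoint g g₀)) (h : β ≤ β') :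
    excess g G xl β' - excess g G xl β ≤ ψ β' * (g β' - g β) := by
  rcases h.eq_or_lt with rfl | h
  · simp
  have i2 := V.left_lower _ _ (V.leftPoint_spec hg hβ').1.1 (V.leftPoint_anti hg hβ hβ' h).le
    (V.leftPoint_spec hg hβ).1.2.le
  have i1 := V.right_upper β β' hβ.1.le h.le
  unfold excess
  linarith

theorem excess_le {β : ℝ} (hβ : β ∈ rightInterval xl (exceedPoint g g₀)) :
    excess g G xl β ≤ ψ β * (g β - g xl) := by
  have h := (V.leftPoint_spec hg hβ).1
  have i1 := V.right_upper xl β le_rfl hβ.1.le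
  have i2 := V.left_lower _ _ h.1 h.2.le le_rfl
  unfold excess
  linarith

theorem excess_pos {β : ℝ} (hβ : β ∈ rightInterval xl (exceedPoint g g₀)) :
    0 < excess g G xl β := by
  have key : ∀ β ∈ rightInterval xl (exceedPoint g g₀), 0 ≤ excess g G xl β := by
    intro β hβ
    have h := V.leftPoint_spec hg hβ
    have i1 := V.right_lower xl β le_rfl hβ.1.le
    have i2 := V.left_upper _ _ h.1.1 h.1.2.le le_rfl
    rw [h.2] at i2
    unfold excess
    linarith
  -- Nonnegativity at a smaller point and strict monotonicity give strict positivity.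
  have hm : (xl + β) / 2 ∈ rightInterval xl (exceedPoint g g₀) :=
    ⟨by linarith [hβ.1], lt_trans (EReal.coe_lt_coe_iff.2 (by linarith [hβ.1])) hβ.2⟩
  exact (key _ hm).trans_lt (V.excess_strictMono hg hm hβ (by linarith [hβ.1]))

theorem excess_small {ε : ℝ} (hε : 0 < ε) :
    ∃ β ∈ rightInterval xl (exceedPoint g g₀), excess g G xl β < ε := by
  obtain ⟨u, hu1, hu2⟩ := EReal.lt_iff_exists_real_btwn.1 (V.lower_lt_exceedPoint hg)
  have hu1 := EReal.coe_lt_coe_iff.1 hu1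
  have hc : Tendsto (fun β => ψ u * (g β - g xl)) (𝓝[>] xl) (𝓝 (ψ u * (g xl - g xl))) :=
    (((V.cont.continuousAt (Ioi_mem_nhds V.pos)).tendsto.sub_const _).const_mul _).mono_left
      -- The weight is frozen at a fixed `u` beyond `xl`, so that the bound on the loss tends to `0`
      -- with `g β - g xl`.
      nhdsWithin_le_nhds
  rw [sub_self, mul_zero] at hc
  obtain ⟨β, hb, hβ⟩ := ((hc.eventually (gt_mem_nhds hε)).and (Ioo_mem_nhdsGT hu1)).exists
  have hm : β ∈ rightInterval xl (exceedPoint g g₀) :=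
    ⟨hβ.1, (EReal.coe_lt_coe_iff.2 hβ.2).trans hu2⟩
  refine ⟨β, hm, ((V.excess_le hg hm).trans ?_).trans_lt hb⟩
  exact mul_le_mul_of_nonneg_right
    (V.weight_mono (V.pos.trans hβ.1) (V.pos.trans hu1) hβ.2).le
    (sub_nonneg.2 (V.min_le (V.pos.trans hβ.1)))

omit V hg in
theorem rightInterval_subset {a b : ℝ} (ha : a ∈ rightInterval xl (exceedPoint g g₀))
    (hb : b ∈ rightInterval xl (exceedPoint g g₀)) :
    Icc a b ⊆ rightInterval xl (exceedPoint g g₀) := fun _ hx =>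
  ⟨ha.1.trans_le hx.1, (EReal.coe_le_coe_iff.2 hx.2).trans_lt hb.2⟩

theorem excess_continuousOn {a b : ℝ} (ha : a ∈ rightInterval xl (exceedPoint g g₀))
    (hb : b ∈ rightInterval xl (exceedPoint g g₀)) : ContinuousOn (excess g G xl) (Icc a b) := by
  have hsub := rightInterval_subset ha hb
  have hbound : ∀ x ∈ Icc a b, ∀ y ∈ Icc a b,
      |excess g G xl x - excess g G xl y| ≤ |ψ b| * |g x - g y| := by
    have main : ∀ x ∈ Icc a b, ∀ y ∈ Icc a b, x ≤ y →
        |excess g G xl y - excess g G xl x| ≤ |ψ b| * |g y - g x| := by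
      intro x hx y hy hxy
      have h1 := (V.excess_strictMono hg).monotoneOn (hsub hx) (hsub hy) hxy
      have h2 := V.mono.monotoneOn (hsub hx).1.le (hsub hy).1.le hxy
      rw [abs_of_nonneg (sub_nonneg.2 h1), abs_of_nonneg (sub_nonneg.2 h2)]
      refine (V.excess_sub_le hg (hsub hx) (hsub hy) hxy).trans
        (mul_le_mul_of_nonneg_right ?_ (sub_nonneg.2 h2))
      exact (V.weight_mono.monotoneOn (V.pos.trans (hsub hy).1) (V.pos.trans hb.1) hy.2).trans
        (le_abs_self _)
    intro x hx y hy
    rcases le_total x y with h | h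
    · rw [abs_sub_comm, abs_sub_comm (g x)]
      exact main x hx y hy h
    · exact main y hy x hx h
  intro y hy
  have hgc : ContinuousWithinAt g (Icc a b) y :=
    (V.cont y (V.pos.trans (hsub hy).1)).mono fun x hx => V.pos.trans (hsub hx).1
  have h0 : Tendsto (fun x => |ψ b| * |g x - g y|) (𝓝[Icc a b] y) (𝓝 (|ψ b| * |g y - g y|)) :=
    ((hgc.tendsto.sub_const _).abs).const_mul _
  rw [sub_self, abs_zero, mul_zero] at h0
  have := squeeze_zero_norm' (f := fun x => excess g G xl x - excess g G xl y)
    (by filter_upwards [self_mem_nhdsWithin] with x hx using hbound x hx y hy) h0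
  exact tendsto_sub_nhds_zero_iff.1 this

omit V hg in
theorem exists_gt {β : ℝ} (hβ : β ∈ rightInterval xl (exceedPoint g g₀)) :
    ∃ β' ∈ rightInterval xl (exceedPoint g g₀), β < β' := by
  obtain ⟨u, hu1, hu2⟩ := EReal.lt_iff_exists_real_btwn.1 hβ.2
  have hu1 := EReal.coe_lt_coe_iff.1 hu1
  exact ⟨u, ⟨hβ.1.trans hu1, hu2⟩, hu1⟩

/-- The supremum is not attained, because the interval has no largest point and the loss is strictly
increasing. -/
theorem excess_mem_costs {β : ℝ} (hβ : β ∈ rightInterval xl (exceedPoint g g₀)) :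
    excess g G xl β ∈ Data.costs (criticalCost g G xl (exceedPoint g g₀)) := by
  obtain ⟨β', hβ', h⟩ := exists_gt hβ
  exact ⟨V.excess_pos hg hβ, (EReal.coe_lt_coe_iff.2 (V.excess_strictMono hg hβ hβ' h)).trans_le
    (le_sSup (mem_image_of_mem _ hβ'))⟩

theorem exists_excess_eq {c : ℝ}
    (hc : c ∈ Data.costs (criticalCost g G xl (exceedPoint g g₀))) :
    ∃ β ∈ rightInterval xl (exceedPoint g g₀), excess g G xl β = c := by
  obtain ⟨a, ha, hac⟩ := V.excess_small hg hc.1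
  obtain ⟨_, ⟨b, hb, rfl⟩, hbc⟩ := lt_sSup_iff.1 hc.2
  have hbc := EReal.coe_lt_coe_iff.1 hbc
  have hab : a ≤ b := ((V.excess_strictMono hg).lt_iff_lt ha hb |>.1 (hac.trans hbc)).le
  obtain ⟨β, hβ, h⟩ := intermediate_value_Icc hab (V.excess_continuousOn hg ha hb)
    ⟨hac.le, hbc.le⟩
  exact ⟨β, rightInterval_subset ha hb hβ, h⟩

theorem excess_tendsto : Tendsto (fun β => (excess g G xl β : EReal)) (upTo (exceedPoint g g₀))
    (𝓝 (criticalCost g G xl (exceedPoint g g₀))) := by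
  have hev := eventually_upTo (V.lower_lt_exceedPoint hg)
  refine tendsto_order.2 ⟨fun a ha => ?_, fun a ha => ?_⟩
  · obtain ⟨_, ⟨b, hb, rfl⟩, hab⟩ := lt_sSup_iff.1 ha
    filter_upwards [eventually_upTo hb.2] with x hx
    have hx1 := EReal.coe_lt_coe_iff.1 hx.1
    exact hab.trans (EReal.coe_lt_coe_iff.2
      (V.excess_strictMono hg hb ⟨hb.1.trans hx1, hx.2⟩ hx1))
  · filter_upwards [hev] with x hx
    have hx' : x ∈ rightInterval xl (exceedPoint g g₀) := ⟨EReal.coe_lt_coe_iff.1 hx.1, hx.2⟩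
    exact (le_sSup (mem_image_of_mem (fun β => (excess g G xl β : EReal)) hx')).trans_lt ha

theorem criticalCost_pos : 0 < criticalCost g G xl (exceedPoint g g₀) := by
  obtain ⟨a, ha, -⟩ := V.excess_small hg one_pos
  have := V.excess_mem_costs hg ha
  exact (EReal.coe_lt_coe_iff.2 this.1).trans this.2

end Valley

/-! ### The free boundaries: uniqueness, limits and finiteness of the critical cost -/

/-- The right free boundary: the solution `β` of `G(Γ(β)) - G(β) = c`. -/
noncomputable def rightBoundary (g G : ℝ → ℝ) (xl : ℝ) (xu : EReal) (c : ℝ) : ℝ :=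
  Classical.epsilon fun β => β ∈ rightInterval xl xu ∧ excess g G xl β = c

/-- The left free boundary. -/
noncomputable def leftBoundary (g G : ℝ → ℝ) (xl : ℝ) (xu : EReal) (c : ℝ) : ℝ :=
  leftPoint g xl (rightBoundary g G xl xu c)

namespace Valley

variable {g G ψ : ℝ → ℝ} {xl : ℝ} {g₀ : EReal}
variable (V : Valley g G ψ xl) (hg : Tendsto (fun x => (g x : EReal)) (𝓝[>] (0 : ℝ)) (𝓝 g₀))

include V hg

theorem rightBoundary_spec {c : ℝ}
    (hc : c ∈ Data.costs (criticalCost g G xl (exceedPoint g g₀))) :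
    rightBoundary g G xl (exceedPoint g g₀) c ∈ rightInterval xl (exceedPoint g g₀) ∧
      excess g G xl (rightBoundary g G xl (exceedPoint g g₀) c) = c := by
  obtain ⟨β, hβ⟩ := V.exists_excess_eq hg hc
  exact Classical.epsilon_spec (p := fun β =>
    β ∈ rightInterval xl (exceedPoint g g₀) ∧ excess g G xl β = c) ⟨β, hβ⟩

theorem rightBoundary_mono : StrictMonoOn (rightBoundary g G xl (exceedPoint g g₀))
    (Data.costs (criticalCost g G xl (exceedPoint g g₀))) := by
  intro c hc c' hc' h
  have h1 := V.rightBoundary_spec hg hc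
  have h2 := V.rightBoundary_spec hg hc'
  rwa [← (V.excess_strictMono hg).lt_iff_lt h1.1 h2.1, h1.2, h2.2]

theorem leftBoundary_anti : StrictAntiOn (leftBoundary g G xl (exceedPoint g g₀))
    (Data.costs (criticalCost g G xl (exceedPoint g g₀))) := fun _ hc _ hc' h =>
  V.leftPoint_anti hg (V.rightBoundary_spec hg hc).1 (V.rightBoundary_spec hg hc').1
    (V.rightBoundary_mono hg hc hc' h)

theorem leftBoundary_mem {c : ℝ}
    (hc : c ∈ Data.costs (criticalCost g G xl (exceedPoint g g₀))) :
    leftBoundary g G xl (exceedPoint g g₀) c ∈ Ioo 0 xl :=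
  (V.leftPoint_spec hg (V.rightBoundary_spec hg hc).1).1

theorem ratio_leftBoundary {c : ℝ}
    (hc : c ∈ Data.costs (criticalCost g G xl (exceedPoint g g₀))) :
    g (leftBoundary g G xl (exceedPoint g g₀) c) = g (rightBoundary g G xl (exceedPoint g g₀) c) :=
  (V.leftPoint_spec hg (V.rightBoundary_spec hg hc).1).2

/-- Strict monotonicity of each branch forces `γ < xl < β`. Then `γ` is the partner of `β`, the loss
at `β` is `c`, and injectivity of the loss concludes. -/
theorem solution_unique {c γ β : ℝ} (hγ : 0 < γ) (h : γ < β) (h1 : g γ = g β)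
    (h2 : G β - G γ = -c) :
    c ∈ Data.costs (criticalCost g G xl (exceedPoint g g₀)) ∧
      γ = leftBoundary g G xl (exceedPoint g g₀) c ∧
      β = rightBoundary g G xl (exceedPoint g g₀) c := by
  have hγl : γ < xl := by
    by_contra! hle
    exact (V.mono hle (hle.trans h.le) h).ne h1
  have hβl : xl < β := by
    by_contra! hle
    exact (V.anti ⟨hγ, hγl.le⟩ ⟨hγ.trans h, hle⟩ h).ne h1.symm
  have hβ : β ∈ rightInterval xl (exceedPoint g g₀) := by
    refine ⟨hβl, (V.lt_exceedPoint_iff hg hβl.le).2 ?_⟩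
    rw [← h1]
    exact V.lt_lim_zero hg ⟨hγ, hγl.le⟩
  have hγ' := V.eq_leftPoint hg hβ ⟨hγ, hγl⟩ h1
  have hex : excess g G xl β = c := by
    unfold excess
    rw [← hγ']
    linarith
  have hc := V.excess_mem_costs hg hβ
  rw [hex] at hc
  have hb := V.rightBoundary_spec hg hc
  have hβ' : β = rightBoundary g G xl (exceedPoint g g₀) c :=
    (V.excess_strictMono hg).injOn hβ hb.1 (hex.trans hb.2.symm)
  refine ⟨hc, ?_, hβ'⟩
  rw [leftBoundary, ← hβ', hγ']

theorem eventually_costs :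
    ∀ᶠ c in 𝓝[>] (0 : ℝ), c ∈ Data.costs (criticalCost g G xl (exceedPoint g g₀)) := by
  obtain ⟨u, hu1, hu2⟩ := EReal.lt_iff_exists_real_btwn.1 (V.criticalCost_pos hg)
  filter_upwards [Ioo_mem_nhdsGT (EReal.coe_lt_coe_iff.1 hu1)] with c hc
  exact ⟨hc.1, (EReal.coe_lt_coe_iff.2 hc.2).trans hu2⟩

theorem eventually_costs_upTo : ∀ᶠ c in upTo (criticalCost g G xl (exceedPoint g g₀)),
    c ∈ Data.costs (criticalCost g G xl (exceedPoint g g₀)) := by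
  filter_upwards [eventually_upTo (V.criticalCost_pos hg)] with c hc
  exact ⟨EReal.coe_lt_coe_iff.1 hc.1, hc.2⟩

theorem rightBoundary_tendsto_zero :
    Tendsto (rightBoundary g G xl (exceedPoint g g₀)) (𝓝[>] (0 : ℝ)) (𝓝 xl) := by
  refine tendsto_order.2 ⟨fun a ha => ?_, fun a ha => ?_⟩
  · filter_upwards [V.eventually_costs hg] with c hc
    exact ha.trans (V.rightBoundary_spec hg hc).1.1
  · obtain ⟨b, hb1, hb2⟩ := EReal.lt_iff_exists_real_btwn.1
      (lt_min (EReal.coe_lt_coe_iff.2 ha) (V.lower_lt_exceedPoint hg))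
    have hb : b ∈ rightInterval xl (exceedPoint g g₀) :=
      ⟨EReal.coe_lt_coe_iff.1 hb1, hb2.trans_le (min_le_right _ _)⟩
    have hba : b < a := EReal.coe_lt_coe_iff.1 (hb2.trans_le (min_le_left _ _))
    filter_upwards [V.eventually_costs hg, Ioo_mem_nhdsGT (V.excess_pos hg hb)] with c hc hcb
    have h := V.rightBoundary_spec hg hc
    refine lt_trans ?_ hba
    rw [← (V.excess_strictMono hg).lt_iff_lt h.1 hb, h.2]
    exact hcb.2

theorem leftBoundary_tendsto_zero :
    Tendsto (leftBoundary g G xl (exceedPoint g g₀)) (𝓝[>] (0 : ℝ)) (𝓝 xl) := by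
  refine tendsto_order.2 ⟨fun a ha => ?_, fun a ha => ?_⟩
  -- The bound `a` may be nonpositive; replacing it by a larger positive point allows the comparison
  -- of levels on the left branch.
  · have ha' : max a (xl / 2) ∈ Ioc 0 xl :=
      ⟨lt_max_of_lt_right (by linarith [V.pos]), max_le ha.le (by linarith [V.pos])⟩
    have hlt : g xl < g (max a (xl / 2)) :=
      V.anti ha' ⟨V.pos, le_rfl⟩ (max_lt ha (by linarith [V.pos]))
    have hc : Tendsto (fun c => g (rightBoundary g G xl (exceedPoint g g₀) c)) (𝓝[>] (0 : ℝ))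
        (𝓝 (g xl)) :=
      (V.cont.continuousAt (Ioi_mem_nhds V.pos)).tendsto.comp (V.rightBoundary_tendsto_zero hg)
    filter_upwards [V.eventually_costs hg, hc.eventually (gt_mem_nhds hlt)] with c hc hcb
    rw [← V.ratio_leftBoundary hg hc, V.anti.lt_iff_gt
      (Ioo_subset_Ioc_self (V.leftBoundary_mem hg hc)) ha'] at hcb
    exact (le_max_left _ _).trans_lt hcb
  · filter_upwards [V.eventually_costs hg] with c hc
    exact (V.leftBoundary_mem hg hc).2.trans ha

theorem eventually_lt_rightBoundary {b : ℝ} (hb : b ∈ rightInterval xl (exceedPoint g g₀)) :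
    ∀ᶠ c in upTo (criticalCost g G xl (exceedPoint g g₀)),
      b < rightBoundary g G xl (exceedPoint g g₀) c := by
  filter_upwards [V.eventually_costs_upTo hg, eventually_upTo (V.excess_mem_costs hg hb).2]
    with c hc hcb
  have h := V.rightBoundary_spec hg hc
  rw [← (V.excess_strictMono hg).lt_iff_lt hb h.1, h.2]
  exact EReal.coe_lt_coe_iff.1 hcb.1

theorem rightBoundary_tendsto_criticalCost :
    Tendsto (fun c => (rightBoundary g G xl (exceedPoint g g₀) c : EReal))
      (upTo (criticalCost g G xl (exceedPoint g g₀))) (𝓝 (exceedPoint g g₀)) := by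
  refine tendsto_order.2 ⟨fun a ha => ?_, fun a ha => ?_⟩
  · obtain ⟨b, hb1, hb2⟩ := EReal.lt_iff_exists_real_btwn.1
      (max_lt ha (V.lower_lt_exceedPoint hg))
    have hb : b ∈ rightInterval xl (exceedPoint g g₀) :=
      ⟨EReal.coe_lt_coe_iff.1 ((le_max_right _ _).trans_lt hb1), hb2⟩
    filter_upwards [V.eventually_lt_rightBoundary hg hb] with c hc
    exact ((le_max_left _ _).trans_lt hb1).trans (EReal.coe_lt_coe_iff.2 hc)
  · filter_upwards [V.eventually_costs_upTo hg] with c hc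
    exact (V.rightBoundary_spec hg hc).1.2.trans ha

/-- A negative level at `a` is also attained on the right branch, at some `b`. Once the right
boundary has passed `b`, its partner lies to the left of `a`. -/
theorem eventually_leftBoundary_lt {a : ℝ} (ha : 0 < a) (h1 : a < xl → g a < 0) :
    ∀ᶠ c in upTo (criticalCost g G xl (exceedPoint g g₀)),
      leftBoundary g G xl (exceedPoint g g₀) c < a := by
  rcases le_or_gt xl a with h | h
  · filter_upwards [V.eventually_costs_upTo hg] with c hc
    exact (V.leftBoundary_mem hg hc).2.trans_le h
  obtain ⟨b, hb, hba⟩ := V.exists_mem_rightInterval hg (V.anti ⟨ha, h.le⟩ ⟨V.pos, le_rfl⟩ h)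
    (V.lt_lim_zero hg ⟨ha, h.le⟩) (h1 h)
  filter_upwards [V.eventually_costs_upTo hg, V.eventually_lt_rightBoundary hg hb] with c hc hcb
  have hlt := V.mono hb.1.le (hb.1.trans hcb).le hcb
  rwa [hba, ← V.ratio_leftBoundary hg hc, V.anti.lt_iff_gt ⟨ha, h.le⟩
    (Ioo_subset_Ioc_self (V.leftBoundary_mem hg hc))] at hlt

theorem leftBoundary_tendsto_criticalCost :
    ∃ l : ℝ, Tendsto (leftBoundary g G xl (exceedPoint g g₀))
        (upTo (criticalCost g G xl (exceedPoint g g₀))) (𝓝 l) ∧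
      (0 < g₀ → 0 < l) ∧ (g₀ ≤ 0 → l = 0) := by
  rcases le_or_gt g₀ 0 with h0 | h0
  · refine ⟨0, tendsto_order.2 ⟨fun a ha => ?_, fun a ha => ?_⟩, fun h => absurd h0 h.not_ge,
      fun _ => rfl⟩
    · filter_upwards [V.eventually_costs_upTo hg] with c hc
      exact ha.trans (V.leftBoundary_mem hg hc).1
    · exact V.eventually_leftBoundary_lt hg ha fun h =>
        EReal.coe_lt_coe_iff.1 ((V.lt_lim_zero hg ⟨ha, h.le⟩).trans_le h0)
  -- The limit is the zero of `g` on the left branch: the levels on the right branch are negative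
  -- and increase to `0`.
  · obtain ⟨l, hl, hgl⟩ := V.exists_left hg (V.neg le_rfl) h0
    refine ⟨l, tendsto_order.2 ⟨fun a ha => ?_, fun a ha => ?_⟩, fun _ => hl.1,
      fun h => absurd h h0.not_ge⟩
    · filter_upwards [V.eventually_costs_upTo hg] with c hc
      have hneg := V.neg (V.rightBoundary_spec hg hc).1.1.le
      rw [← V.ratio_leftBoundary hg hc, ← hgl, V.anti.lt_iff_gt
        (Ioo_subset_Ioc_self (V.leftBoundary_mem hg hc)) (Ioo_subset_Ioc_self hl)] at hneg
      exact ha.trans hneg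
    · refine V.eventually_leftBoundary_lt hg (hl.1.trans ha) fun h => ?_
      rw [← hgl]
      exact V.anti (Ioo_subset_Ioc_self hl) ⟨hl.1.trans ha, h.le⟩ ha

theorem criticalCost_lt_top (h : exceedPoint g g₀ < ⊤) :
    criticalCost g G xl (exceedPoint g g₀) < ⊤ := by
  obtain ⟨u, hu1, hu2⟩ := EReal.lt_iff_exists_real_btwn.1 h
  refine lt_of_le_of_lt (sSup_le ?_) (EReal.coe_lt_top (ψ u * (g u - g xl)))
  rintro _ ⟨β, hβ, rfl⟩
  have hβu : β < u := EReal.coe_lt_coe_iff.1 (hβ.2.trans hu1)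
  have hβ0 := V.pos.trans hβ.1
  have hgβ : 0 < g β - g xl := sub_pos.2 (V.mono self_mem_Ici hβ.1.le hβ.1)
  have hgu := V.mono hβ.1.le (hβ.1.trans hβu).le hβu
  have hψ := V.weight_mono hβ0 (hβ0.trans hβu) hβu
  have hT := V.excess_le hg hβ
  have hT0 := V.excess_pos hg hβ
  have hψβ : 0 < ψ β := pos_of_mul_pos_left (hT0.trans_le hT) hgβ.le
  rw [EReal.coe_le_coe_iff]
  refine hT.trans ?_
  exact mul_le_mul hψ.le (by linarith) hgβ.le (hψβ.trans hψ).le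

/-- In the application `G + g ψ` is the resolvent `R_Θ`. Bounded losses bound it below by letting `β
→ ∞`, where the level `g β` vanishes; conversely `-g β * ψ β ≥ 0` turns a lower bound on the
resolvent into one on `G β`. -/
theorem criticalCost_lt_top_iff (hψ : ∀ x, 0 < x → 0 ≤ ψ x) (h : exceedPoint g g₀ = ⊤) :
    criticalCost g G xl (exceedPoint g g₀) < ⊤ ↔ ∃ M, ∀ x, xl < x → M ≤ G x + g x * ψ x := by
  have hmem : ∀ β, xl < β → β ∈ rightInterval xl (exceedPoint g g₀) := fun β hβ =>
    ⟨hβ, h ▸ EReal.coe_lt_top β⟩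
  constructor
  · intro hc
    obtain ⟨K, hK, -⟩ := EReal.lt_iff_exists_real_btwn.1 hc
    refine ⟨G xl + g xl * ψ xl - K, fun x hx => ?_⟩
    -- The loss at `β` is split at `xl` and `x`: the stretch from `x` to `β` is weighted by `ψ x`,
    -- the left branch by `ψ xl`, and the stretch from `xl` to `x` is kept exactly.
    have key : ∀ β, x ≤ β → (ψ x - ψ xl) * g β + (G xl + g xl * ψ xl) -
        (G x + g x * ψ x) ≤ K := by
      intro β hβ
      have hb := hmem β (hx.trans_le hβ)
      have hT : excess g G xl β ≤ K := (EReal.coe_lt_coe_iff.1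
        ((le_sSup (mem_image_of_mem (fun β => (excess g G xl β : EReal)) hb)).trans_lt hK)).le
      have hl := V.leftPoint_spec hg hb
      have i1 := V.right_lower x β hx.le hβ
      have i2 := V.left_upper _ _ hl.1.1 hl.1.2.le le_rfl
      rw [hl.2] at i2
      unfold excess at hT
      linarith
    have hlim : Tendsto (fun β => (ψ x - ψ xl) * g β + (G xl + g xl * ψ xl) -
        (G x + g x * ψ x)) atTop (𝓝 ((ψ x - ψ xl) * 0 + (G xl + g xl * ψ xl) -
        (G x + g x * ψ x))) := ((V.lim.const_mul _).add_const _).sub_const _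
    have := le_of_tendsto hlim ((eventually_ge_atTop x).mono key)
    linarith
  · rintro ⟨M, hM⟩
    refine lt_of_le_of_lt (sSup_le ?_) (EReal.coe_lt_top (G xl - M))
    rintro _ ⟨β, hβ, rfl⟩
    have hl := (V.leftPoint_spec hg hβ).1
    have i2 := V.left_lower _ _ hl.1 hl.2.le le_rfl
    have i3 := mul_nonneg (neg_nonneg.2 (V.neg hβ.1.le).le) (hψ β (V.pos.trans hβ.1))
    have := hM β hβ.1
    rw [EReal.coe_le_coe_iff]
    unfold excess
    linarith

end Valley

end ImpulseControl

/-! ### Calculus on the half-line, the equation in divergence form, and fluxes -/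

namespace ImpulseControl

theorem hasDerivAt_integral_of_continuousOn {f : ℝ → ℝ} (hf : ContinuousOn f (Ioi 0)) {a x : ℝ}
    (ha : 0 < a) (hx : 0 < x) : HasDerivAt (fun u => ∫ s in a..u, f s) (f x) x := by
  refine intervalIntegral.integral_hasDerivAt_right ?_ ?_ (hf.continuousAt (Ioi_mem_nhds hx))
  · refine (hf.mono fun y hy => ?_).intervalIntegrable
    exact (lt_min ha hx).trans_le hy.1
  · exact hf.stronglyMeasurableAtFilter isOpen_Ioi x hx

theorem hasDerivAt_of_contDiffOn_two {u : ℝ → ℝ} (hu : ContDiffOn ℝ 2 u (Ioi 0)) {x : ℝ}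
    (hx : 0 < x) : HasDerivAt u (deriv u x) x ∧ HasDerivAt (deriv u) (deriv (deriv u) x) x := by
  have h1 : ContDiffOn ℝ 1 (deriv u) (Ioi 0) :=
    ((contDiffOn_succ_iff_deriv_of_isOpen (n := 1) isOpen_Ioi).1 hu).2.2
  exact ⟨((hu.differentiableOn (by norm_num)).differentiableAt (Ioi_mem_nhds hx)).hasDerivAt,
    ((h1.differentiableOn (by norm_num)).differentiableAt (Ioi_mem_nhds hx)).hasDerivAt⟩

/-- A nonnegative derivative on `]0, b]` of a function bounded below is integrable. -/
theorem integrableOn_deriv_of_nonneg_of_bddBelow {V V' : ℝ → ℝ} {b m : ℝ}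
    (hV : ∀ x, 0 < x → HasDerivAt V (V' x) x) (hV' : ∀ x ∈ Ioc 0 b, 0 ≤ V' x)
    (h0 : ∀ x ∈ Ioc 0 b, m ≤ V x) (hb : 0 < b) :
    IntegrableOn V' (Ioc 0 b) := by
  have hmono : MonotoneOn V (Ioc 0 b) := by
    refine monotoneOn_of_deriv_nonneg (convex_Ioc 0 b)
      (fun x hx => (hV x hx.1).continuousAt.continuousWithinAt) ?_ ?_
    all_goals rw [interior_Ioc]
    · exact fun x hx => (hV x hx.1).differentiableAt.differentiableWithinAt
    · exact fun x hx => (hV x hx.1).deriv ▸ hV' x (Ioo_subset_Ioc_self hx)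
  have hbdd : BddBelow (V '' Ioc 0 b) := ⟨m, by rintro _ ⟨x, hx, rfl⟩; exact h0 x hx⟩
  set l := sInf (V '' Ioc 0 b) with hl
  have hlim : Tendsto V (𝓝[>] 0) (𝓝 l) := by
    refine tendsto_order.2 ⟨fun a ha => ?_, fun a ha => ?_⟩
    · filter_upwards [Ioc_mem_nhdsGT hb] with x hx
      exact ha.trans_le (csInf_le hbdd (mem_image_of_mem _ hx))
    · obtain ⟨_, ⟨y, hy, rfl⟩, hya⟩ := exists_lt_of_csInf_lt
        ((nonempty_Ioc.2 hb).image V) ha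
      filter_upwards [Ioc_mem_nhdsGT hy.1] with x hx
      exact (hmono ⟨hx.1, hx.2.trans hy.2⟩ hy hx.2).trans_lt hya
  -- Giving `V` its right limit as value at `0` makes it continuous on the closed interval.
  refine intervalIntegral.integrableOn_deriv_of_nonneg (g := Function.update V 0 l) ?_ ?_
    fun x hx => hV' x (Ioo_subset_Ioc_self hx)
  · intro x hx
    rcases hx.1.eq_or_lt with rfl | hx0
    · rw [continuousWithinAt_update_same]
      exact hlim.mono_left (nhdsWithin_mono _ fun y hy => lt_of_le_of_ne hy.1.1 (Ne.symm hy.2))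
    · exact ((continuousAt_update_of_ne hx0.ne').2 (hV x hx0).continuousAt).continuousWithinAt
  · intro x hx
    refine (hV x hx.1).congr_of_eventuallyEq ?_
    filter_upwards [Ioi_mem_nhds hx.1] with y hy
    exact Function.update_of_ne (ne_of_gt hy) _ _

theorem exists_tendsto_atTop_of_deriv_nonneg {V V' : ℝ → ℝ} {a m : ℝ}
    (hV : ∀ x, a ≤ x → HasDerivAt V (V' x) x) (hV' : ∀ x, a ≤ x → 0 ≤ V' x)
    (h0 : ∀ x, a ≤ x → V x ≤ m) : ∃ l, Tendsto V atTop (𝓝 l) := by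
  have hmono : MonotoneOn V (Ici a) := by
    refine monotoneOn_of_deriv_nonneg (convex_Ici a)
      (fun x hx => (hV x hx).continuousAt.continuousWithinAt) ?_ ?_
    all_goals rw [interior_Ici]
    · exact fun x hx => (hV x (le_of_lt hx)).differentiableAt.differentiableWithinAt
    · exact fun x hx => (hV x (le_of_lt hx)).deriv ▸ hV' x (le_of_lt hx)
  have hm : Monotone fun x => V (max a x) := fun x y h =>
    hmono (le_max_left a x) (le_max_left a y) (max_le_max le_rfl h)
  refine ⟨_, (tendsto_atTop_ciSup hm
    ⟨m, by rintro _ ⟨x, rfl⟩; exact h0 _ (le_max_left _ _)⟩).congr' ?_⟩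
  filter_upwards [eventually_ge_atTop a] with x hx
  rw [max_eq_right hx]

theorem integrableOn_Ioi_deriv_of_bddAbove {V V' : ℝ → ℝ} {a m : ℝ}
    (hV : ∀ x, a ≤ x → HasDerivAt V (V' x) x) (hV' : ∀ x, a ≤ x → 0 ≤ V' x)
    (h0 : ∀ x, a ≤ x → V x ≤ m) : IntegrableOn V' (Ioi a) := by
  obtain ⟨l, hl⟩ := exists_tendsto_atTop_of_deriv_nonneg hV hV' h0
  exact integrableOn_Ioi_deriv_of_nonneg' hV (fun x hx => hV' x (le_of_lt hx)) hl

theorem setLIntegral_ne_top_of_le_integrableOn {s : Set ℝ} (hs : MeasurableSet s) {f : ℝ → ENNReal}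
    {v : ℝ → ℝ} (hv : IntegrableOn v s) (h : ∀ x ∈ s, f x ≤ ENNReal.ofReal (v x)) :
    ∫⁻ x in s, f x ≠ ⊤ := by
  have h1 : ∫⁻ x in s, f x ≤ ∫⁻ x in s, ENNReal.ofReal (v x) := setLIntegral_mono' hs h
  exact (h1.trans_lt hv.lintegral_lt_top).ne

namespace Data

variable (D : Data)

/-- The density of the speed measure. -/
noncomputable def speedDensity (x : ℝ) : ℝ := 2 / ((D.σ x) ^ 2 * D.scaleDeriv x)

theorem scaleDeriv_pos (x : ℝ) : 0 < D.scaleDeriv x := Real.exp_pos _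

theorem scaleDeriv_one : D.scaleDeriv 1 = 1 := by simp [scaleDeriv]

namespace StandingAssumptions

variable {D} {φ ψ : ℝ → ℝ} {ξ : ℝ} (hD : D.StandingAssumptions φ ψ ξ)

include hD

theorem b_continuousOn : ContinuousOn D.b (Ioi 0) :=
  hD.b_lip.continuousOn.mono Ioi_subset_Ici_self

theorem σ_continuousOn : ContinuousOn D.σ (Ioi 0) :=
  hD.σ_lip.continuousOn.mono Ioi_subset_Ici_self

theorem r_continuousOn : ContinuousOn D.r (Ioi 0) :=
  hD.r_cont.mono Ioi_subset_Ici_self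

theorem r_pos' {x : ℝ} (hx : 0 < x) : 0 < D.r x := by
  obtain ⟨r₀, h0, h⟩ := hD.r_pos
  exact h0.trans_le (h x hx.le)

theorem speedDensity_pos {x : ℝ} (hx : 0 < x) : 0 < D.speedDensity x :=
  div_pos two_pos (mul_pos (pow_pos (hD.σ_pos x hx) 2) (D.scaleDeriv_pos x))

theorem hasDerivAt_scaleDeriv {x : ℝ} (hx : 0 < x) :
    HasDerivAt D.scaleDeriv (-2 * D.b x / (D.σ x) ^ 2 * D.scaleDeriv x) x := by
  have hc : ContinuousOn (fun s => D.b s / (D.σ s) ^ 2) (Ioi 0) :=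
    hD.b_continuousOn.div (hD.σ_continuousOn.pow 2) fun s hs => (pow_pos (hD.σ_pos s hs) 2).ne'
  have := ((hasDerivAt_integral_of_continuousOn hc one_pos hx).const_mul (-2)).exp
  refine this.congr_deriv ?_
  simp only [scaleDeriv]
  ring

theorem scaleDeriv_continuousOn : ContinuousOn D.scaleDeriv (Ioi 0) := fun _ hx =>
  (hD.hasDerivAt_scaleDeriv hx).continuousAt.continuousWithinAt

theorem hasDerivAt_scale {x : ℝ} (hx : 0 < x) : HasDerivAt D.scale (D.scaleDeriv x) x :=
  hasDerivAt_integral_of_continuousOn hD.scaleDeriv_continuousOn one_pos hx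

theorem speedDensity_continuousOn : ContinuousOn D.speedDensity (Ioi 0) :=
  continuousOn_const.div ((hD.σ_continuousOn.pow 2).mul hD.scaleDeriv_continuousOn) fun x hx =>
    (mul_pos (pow_pos (hD.σ_pos x hx) 2) (D.scaleDeriv_pos x)).ne'

/-- Because `p'' = -(2b/σ²) p'`, dividing by `p'` absorbs the drift and puts `ℒ u = 0` in divergence
form. -/
theorem hasDerivAt_div_scaleDeriv {u : ℝ → ℝ} (hu : ContDiffOn ℝ 2 u (Ioi 0))
    (hode : ∀ x, 0 < x → D.op u x = 0) {x : ℝ} (hx : 0 < x) :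
    HasDerivAt (fun x => deriv u x / D.scaleDeriv x) (D.r x * u x * D.speedDensity x) x := by
  have h := (hasDerivAt_of_contDiffOn_two hu hx).2.div (hD.hasDerivAt_scaleDeriv hx)
    (D.scaleDeriv_pos x).ne'
  refine h.congr_deriv ?_
  have hode := hode x hx
  have hσ := (hD.σ_pos x hx).ne'
  have hp := (D.scaleDeriv_pos x).ne'
  unfold op at hode
  unfold speedDensity
  field_simp
  linear_combination 2 * hode

theorem hasDerivAt_φ {x : ℝ} (hx : 0 < x) : HasDerivAt φ (deriv φ x) x :=
  (hasDerivAt_of_contDiffOn_two hD.fundamental.φ_smooth hx).1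

theorem hasDerivAt_ψ {x : ℝ} (hx : 0 < x) : HasDerivAt ψ (deriv ψ x) x :=
  (hasDerivAt_of_contDiffOn_two hD.fundamental.ψ_smooth hx).1

theorem ψ_strictMonoOn : StrictMonoOn ψ (Ioi 0) := by
  refine strictMonoOn_of_deriv_pos (convex_Ioi 0)
    (fun x hx => (hD.hasDerivAt_ψ hx).continuousAt.continuousWithinAt) ?_
  rw [interior_Ioi]
  exact hD.fundamental.ψ_deriv

theorem φ_strictAntiOn : StrictAntiOn φ (Ioi 0) := by
  refine strictAntiOn_of_deriv_neg (convex_Ioi 0)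
    (fun x hx => (hD.hasDerivAt_φ hx).continuousAt.continuousWithinAt) ?_
  rw [interior_Ioi]
  exact hD.fundamental.φ_deriv

theorem wronskian_pos : 0 < wronskian φ ψ := by
  have h := hD.fundamental
  have h1 := mul_pos (h.φ_pos 1 one_pos) (h.ψ_deriv 1 one_pos)
  have h2 := mul_pos_of_neg_of_neg (h.φ_deriv 1 one_pos) (neg_neg_of_pos (h.ψ_pos 1 one_pos))
  unfold wronskian
  linarith

theorem wronskian_eq {x : ℝ} (hx : 0 < x) :
    φ x * deriv ψ x - deriv φ x * ψ x = wronskian φ ψ * D.scaleDeriv x := by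
  have hF : ∀ y ∈ Ioi (0 : ℝ), HasDerivAt (fun y => φ y * (deriv ψ y / D.scaleDeriv y) -
      deriv φ y / D.scaleDeriv y * ψ y) 0 y := by
    intro y hy
    have h1 := (hD.hasDerivAt_φ hy).mul
      (hD.hasDerivAt_div_scaleDeriv hD.fundamental.ψ_smooth hD.fundamental.ψ_ode hy)
    have h2 := (hD.hasDerivAt_div_scaleDeriv hD.fundamental.φ_smooth hD.fundamental.φ_ode hy).mul
      (hD.hasDerivAt_ψ hy)
    exact (h1.sub h2).congr_deriv (by ring)
  have hc := isOpen_Ioi.is_const_of_deriv_eq_zero isPreconnected_Ioi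
    (fun y hy => (hF y hy).differentiableAt.differentiableWithinAt)
    (fun y hy => (hF y hy).deriv) (mem_Ioi.2 hx) (mem_Ioi.2 one_pos)
  have hp := (D.scaleDeriv_pos x).ne'
  simp only [D.scaleDeriv_one, div_one] at hc
  unfold wronskian
  rw [← hc]
  field_simp

end StandingAssumptions

section Flux

variable (φ ψ : ℝ → ℝ)

/-- The normalised flux `ψ' / (C p')`, equal to `∫_0^x r Ψ ds`. -/
noncomputable def fluxPsi (x : ℝ) : ℝ := deriv ψ x / (wronskian φ ψ * D.scaleDeriv x)

/-- The normalised flux `-φ' / (C p')`, equal to `∫_x^∞ r Φ ds`. -/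
noncomputable def fluxPhi (x : ℝ) : ℝ := -deriv φ x / (wronskian φ ψ * D.scaleDeriv x)

theorem capPsi_eq (x : ℝ) : D.capPsi φ ψ x = ψ x * D.speedDensity x / wronskian φ ψ := by
  simp only [capPsi, speedDensity, div_eq_mul_inv, mul_inv]
  ring

theorem capPhi_eq (x : ℝ) : D.capPhi φ ψ x = φ x * D.speedDensity x / wronskian φ ψ := by
  simp only [capPhi, speedDensity, div_eq_mul_inv, mul_inv]
  ring

end Flux

namespace StandingAssumptions

variable {D} {φ ψ : ℝ → ℝ} {ξ : ℝ} (hD : D.StandingAssumptions φ ψ ξ)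

include hD

theorem fluxPsi_pos {x : ℝ} (hx : 0 < x) : 0 < D.fluxPsi φ ψ x :=
  div_pos (hD.fundamental.ψ_deriv x hx) (mul_pos hD.wronskian_pos (D.scaleDeriv_pos x))

theorem fluxPhi_pos {x : ℝ} (hx : 0 < x) : 0 < D.fluxPhi φ ψ x :=
  div_pos (neg_pos.2 (hD.fundamental.φ_deriv x hx))
    (mul_pos hD.wronskian_pos (D.scaleDeriv_pos x))

/-- This is the Wronskian relation. Once the fluxes are known to be integrals of `rΨ` and `rΦ`, it
says that the resolvent of `r` is `1`. -/
theorem flux_identity {x : ℝ} (hx : 0 < x) :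
    φ x * D.fluxPsi φ ψ x + ψ x * D.fluxPhi φ ψ x = 1 := by
  have h := hD.wronskian_eq hx
  have hp := (D.scaleDeriv_pos x).ne'
  have hC := hD.wronskian_pos.ne'
  unfold fluxPsi fluxPhi
  field_simp
  linarith

theorem capPsi_pos {x : ℝ} (hx : 0 < x) : 0 < D.capPsi φ ψ x := by
  rw [capPsi_eq]
  exact div_pos (mul_pos (hD.fundamental.ψ_pos x hx) (hD.speedDensity_pos hx)) hD.wronskian_pos

theorem capPhi_pos {x : ℝ} (hx : 0 < x) : 0 < D.capPhi φ ψ x := by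
  rw [capPhi_eq]
  exact div_pos (mul_pos (hD.fundamental.φ_pos x hx) (hD.speedDensity_pos hx)) hD.wronskian_pos

theorem capPsi_continuousOn : ContinuousOn (D.capPsi φ ψ) (Ioi 0) := by
  rw [funext (D.capPsi_eq φ ψ)]
  exact (ContinuousOn.mul (fun x hx => (hD.hasDerivAt_ψ hx).continuousAt.continuousWithinAt)
    hD.speedDensity_continuousOn).div_const _

theorem capPhi_continuousOn : ContinuousOn (D.capPhi φ ψ) (Ioi 0) := by
  rw [funext (D.capPhi_eq φ ψ)]
  exact (ContinuousOn.mul (fun x hx => (hD.hasDerivAt_φ hx).continuousAt.continuousWithinAt)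
    hD.speedDensity_continuousOn).div_const _

theorem hasDerivAt_fluxPsi {x : ℝ} (hx : 0 < x) :
    HasDerivAt (D.fluxPsi φ ψ) (D.r x * D.capPsi φ ψ x) x := by
  have h := (hD.hasDerivAt_div_scaleDeriv hD.fundamental.ψ_smooth
    hD.fundamental.ψ_ode hx).div_const (wronskian φ ψ)
  rw [capPsi_eq]
  refine (h.congr_deriv (by ring)).congr_of_eventuallyEq (Eventually.of_forall fun y => ?_)
  simp only [fluxPsi, div_eq_mul_inv, mul_inv]
  ring

theorem hasDerivAt_fluxPhi {x : ℝ} (hx : 0 < x) :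
    HasDerivAt (D.fluxPhi φ ψ) (-(D.r x * D.capPhi φ ψ x)) x := by
  have h := ((hD.hasDerivAt_div_scaleDeriv hD.fundamental.φ_smooth
    hD.fundamental.φ_ode hx).div_const (wronskian φ ψ)).neg
  rw [capPhi_eq]
  refine (h.congr_deriv (by ring)).congr_of_eventuallyEq (Eventually.of_forall fun y => ?_)
  simp only [fluxPhi, div_eq_mul_inv, mul_inv, Pi.neg_apply]
  ring

theorem deriv_ψ_eq {x : ℝ} :
    deriv ψ x = wronskian φ ψ * D.scaleDeriv x * D.fluxPsi φ ψ x := by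
  have hp := (D.scaleDeriv_pos x).ne'
  have hC := hD.wronskian_pos.ne'
  unfold fluxPsi
  field_simp

theorem deriv_φ_eq {x : ℝ} :
    deriv φ x = -(wronskian φ ψ * D.scaleDeriv x * D.fluxPhi φ ψ x) := by
  have hp := (D.scaleDeriv_pos x).ne'
  have hC := hD.wronskian_pos.ne'
  unfold fluxPhi
  field_simp

/-! ### Consequences of the boundary classification -/

theorem speed_Ioc {a b : ℝ} (ha : 0 < a) (hab : a ≤ b) :
    D.speed (Ioc a b) = ENNReal.ofReal (∫ x in a..b, D.speedDensity x) := by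
  have hsub : Icc a b ⊆ Ioi 0 := fun x hx => ha.trans_le hx.1
  have hint : IntegrableOn D.speedDensity (Ioc a b) :=
    (hD.speedDensity_continuousOn.mono hsub).integrableOn_Icc.mono_set Ioc_subset_Icc_self
  rw [speed, withDensity_apply _ measurableSet_Ioc, Measure.restrict_restrict measurableSet_Ioc,
    inter_eq_left.2 (Ioc_subset_Icc_self.trans hsub), intervalIntegral.integral_of_le hab,
    ofReal_integral_eq_lintegral_ofReal hint]
  · rfl
  · filter_upwards [ae_restrict_mem measurableSet_Ioc] with x hx
    exact (hD.speedDensity_pos (ha.trans hx.1)).le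

/-- Since `0` is inaccessible, `ψ' / p'` vanishes at `0`. -/
theorem exists_fluxPsi_lt {q₀ : ℝ} (hq : 0 < q₀) : ∃ x ∈ Ioc (0 : ℝ) 1, D.fluxPsi φ ψ x < q₀ := by
  by_contra! hge
  obtain ⟨r₀, hr₀, hr⟩ := hD.r_pos
  have hC := hD.wronskian_pos
  set M : ℝ → ℝ := fun y => ∫ x in (1 : ℝ)..y, D.speedDensity x with hM
  have hMd : ∀ y, 0 < y → HasDerivAt M (D.speedDensity y) y := fun y hy =>
    hasDerivAt_integral_of_continuousOn hD.speedDensity_continuousOn one_pos hy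
  have hM0 : ∀ y ∈ Ioc (0 : ℝ) 1, 0 ≤ -M y := fun y hy => by
    simp only [hM]
    rw [neg_nonneg, intervalIntegral.integral_symm, neg_nonpos]
    exact intervalIntegral.integral_nonneg hy.2
      fun x hx => (hD.speedDensity_pos (hy.1.trans_le hx.1)).le
  -- Here `-M y = m(]y,1])`. The flux term, scaled by `C/r₀`, compensates the derivative of `M`
  -- because `r ≥ r₀`, so `-M ψ'` is integrable near `0`. A flux bounded below by `q₀` means `ψ' ≥ C
  -- q₀ p'`, and then the Feller integral would be finite.
  have hV := integrableOn_deriv_of_nonneg_of_bddBelow (m := 0)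
    (V := fun y => -M y * ψ y + wronskian φ ψ / r₀ * D.fluxPsi φ ψ y)
    (V' := fun y => -D.speedDensity y * ψ y + -M y * deriv ψ y +
      wronskian φ ψ / r₀ * (D.r y * D.capPsi φ ψ y))
    (fun y hy => ((hMd y hy).neg.mul (hD.hasDerivAt_ψ hy)).add
      ((hD.hasDerivAt_fluxPsi hy).const_mul _)) (b := 1)
  have hle : ∀ y ∈ Ioc (0 : ℝ) 1, -M y * deriv ψ y ≤ -D.speedDensity y * ψ y + -M y * deriv ψ y +
      wronskian φ ψ / r₀ * (D.r y * D.capPsi φ ψ y) := by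
    intro y hy
    have h1 := mul_nonneg (sub_nonneg.2 (hr y hy.1.le))
      (mul_pos (hD.speedDensity_pos hy.1) (hD.fundamental.ψ_pos y hy.1)).le
    have h2 : -D.speedDensity y * ψ y + wronskian φ ψ / r₀ * (D.r y * D.capPsi φ ψ y) =
        (D.r y - r₀) * (D.speedDensity y * ψ y) / r₀ := by
      rw [capPsi_eq]
      field_simp
      ring
    have := div_nonneg h1 hr₀.le
    linarith
  have hnn : ∀ y ∈ Ioc (0 : ℝ) 1, 0 ≤ -M y * deriv ψ y := fun y hy =>
    mul_nonneg (hM0 y hy) (hD.fundamental.ψ_deriv y hy.1).le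
  have hV := hV (fun y hy => (hnn y hy).trans (hle y hy))
    (fun y hy => add_nonneg (mul_nonneg (hM0 y hy) (hD.fundamental.ψ_pos y hy.1).le)
      (mul_pos (div_pos hC hr₀) (hD.fluxPsi_pos hy.1)).le) one_pos
  refine setLIntegral_ne_top_of_le_integrableOn measurableSet_Ioc
    (hV.const_mul (wronskian φ ψ * q₀)⁻¹) ?_ hD.zero_inaccessible
  intro y hy
  rw [hD.speed_Ioc hy.1 hy.2, intervalIntegral.integral_symm,
    ← ENNReal.ofReal_mul (hM0 y hy)]
  refine ENNReal.ofReal_le_ofReal ?_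
  rw [← div_eq_inv_mul, le_div_iff₀ (mul_pos hC hq)]
  refine le_trans ?_ (hle y hy)
  rw [hD.deriv_ψ_eq (φ := φ), mul_assoc (-M y)]
  refine mul_le_mul_of_nonneg_left ?_ (hM0 y hy)
  have := mul_le_mul_of_nonneg_left (hge y hy) (mul_pos hC (D.scaleDeriv_pos y)).le
  linarith

/-- Since `∞` is not an exit boundary, `φ' / p'` vanishes at `∞`. -/
theorem exists_fluxPhi_lt {q₀ : ℝ} (hq : 0 < q₀) : ∃ x, 1 ≤ x ∧ D.fluxPhi φ ψ x < q₀ := by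
  by_contra! hge
  obtain ⟨r₀, hr₀, hr⟩ := hD.r_pos
  have hC := hD.wronskian_pos
  have pos : ∀ {y : ℝ}, 1 ≤ y → 0 < y := fun hy => one_pos.trans_le hy
  set M : ℝ → ℝ := fun y => ∫ x in (1 : ℝ)..y, D.speedDensity x with hM
  have hMd : ∀ y, 0 < y → HasDerivAt M (D.speedDensity y) y := fun y hy =>
    hasDerivAt_integral_of_continuousOn hD.speedDensity_continuousOn one_pos hy
  have hM0 : ∀ y, 1 ≤ y → 0 ≤ M y := fun y hy =>
    intervalIntegral.integral_nonneg hy fun x hx => (hD.speedDensity_pos (pos hx.1)).le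
  -- The mirror image of the argument at `0`: `-M φ'` is integrable at infinity, and a flux bounded
  -- below would make the first Feller integral finite.
  have hV := integrableOn_Ioi_deriv_of_bddAbove (m := 0) (a := 1)
    (V := fun y => -(M y * φ y) - wronskian φ ψ / r₀ * D.fluxPhi φ ψ y)
    (V' := fun y => -(D.speedDensity y * φ y + M y * deriv φ y) -
      wronskian φ ψ / r₀ * (-(D.r y * D.capPhi φ ψ y)))
    (fun y hy => (((hMd y (pos hy)).mul (hD.hasDerivAt_φ (pos hy))).neg).sub
      ((hD.hasDerivAt_fluxPhi (pos hy)).const_mul _))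
  have hle : ∀ y, 1 ≤ y → -(M y * deriv φ y) ≤ -(D.speedDensity y * φ y + M y * deriv φ y) -
      wronskian φ ψ / r₀ * (-(D.r y * D.capPhi φ ψ y)) := by
    intro y hy
    have h1 := mul_nonneg (sub_nonneg.2 (hr y (pos hy).le))
      (mul_pos (hD.speedDensity_pos (pos hy)) (hD.fundamental.φ_pos y (pos hy))).le
    have h2 : -(D.speedDensity y * φ y) - wronskian φ ψ / r₀ * (-(D.r y * D.capPhi φ ψ y)) =
        (D.r y - r₀) * (D.speedDensity y * φ y) / r₀ := by
      rw [capPhi_eq]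
      field_simp
      ring
    have := div_nonneg h1 hr₀.le
    linarith
  have hnn : ∀ y, 1 ≤ y → 0 ≤ -(M y * deriv φ y) := fun y hy => by
    have := mul_nonneg (hM0 y hy) (neg_pos.2 (hD.fundamental.φ_deriv y (pos hy))).le
    linarith
  have hV := hV (fun y hy => (hnn y hy).trans (hle y hy)) fun y hy => by
    have h1 := mul_nonneg (hM0 y hy) (hD.fundamental.φ_pos y (pos hy)).le
    have h2 := mul_pos (div_pos hC hr₀) (hD.fluxPhi_pos (pos hy))
    linarith
  refine setLIntegral_ne_top_of_le_integrableOn measurableSet_Ioi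
    (hV.const_mul (wronskian φ ψ * q₀)⁻¹) ?_ hD.infty_natural.1
  intro y hy
  have hy := le_of_lt (mem_Ioi.1 hy)
  rw [hD.speed_Ioc one_pos hy, ← ENNReal.ofReal_mul (hM0 y hy)]
  refine ENNReal.ofReal_le_ofReal ?_
  rw [← div_eq_inv_mul, le_div_iff₀ (mul_pos hC hq)]
  refine le_trans ?_ (hle y hy)
  rw [hD.deriv_φ_eq (ψ := ψ), mul_neg, neg_neg, mul_assoc (M y)]
  refine mul_le_mul_of_nonneg_left ?_ (hM0 y hy)
  have := mul_le_mul_of_nonneg_left (hge y hy) (mul_pos hC (D.scaleDeriv_pos y)).le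
  linarith

theorem setLIntegral_speed (f : ℝ → ENNReal) : ∫⁻ y in Ioi (1 : ℝ), f y ∂D.speed =
    ∫⁻ y in Ioi (1 : ℝ), ENNReal.ofReal (D.speedDensity y) * f y := by
  have hmeas : AEMeasurable (fun x => ENNReal.ofReal (D.speedDensity x))
      (volume.restrict (Ioi 1)) :=
    ((hD.speedDensity_continuousOn.mono (Ioi_subset_Ioi zero_le_one)).aemeasurable
      measurableSet_Ioi).ennreal_ofReal
  have hr : (volume.restrict (Ioi (0 : ℝ))).restrict (Ioi 1) = volume.restrict (Ioi 1) := by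
    rw [Measure.restrict_restrict measurableSet_Ioi,
      inter_eq_left.2 (Ioi_subset_Ioi zero_le_one)]
  rw [speed, restrict_withDensity measurableSet_Ioi, hr]
  exact lintegral_withDensity_eq_lintegral_mul_non_measurable₀ _ hmeas
    (Eventually.of_forall fun x => ENNReal.ofReal_lt_top) f

/-- Since `∞` is not an entrance boundary, `φ` vanishes at `∞`. -/
theorem exists_φ_lt {q₀ : ℝ} (hq : 0 < q₀) : ∃ x, 1 ≤ x ∧ φ x < q₀ := by
  by_contra! hge
  obtain ⟨r₀, hr₀, hr⟩ := hD.r_pos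
  have hC := hD.wronskian_pos
  have pos : ∀ {y : ℝ}, 1 ≤ y → 0 < y := fun hy => one_pos.trans_le hy
  have hP0 : ∀ y, 1 ≤ y → 0 ≤ D.scale y := fun y hy =>
    intervalIntegral.integral_nonneg hy fun x _ => (D.scaleDeriv_pos x).le
  have hnn : ∀ y, 1 ≤ y → 0 ≤ D.scale y * (D.r y * D.capPhi φ ψ y) := fun y hy =>
    mul_nonneg (hP0 y hy) (mul_pos (hD.r_pos' (pos hy)) (hD.capPhi_pos (pos hy))).le
  -- Integration by parts: the derivative of `φ/C` cancels the term with `p'`, so `p r Φ` is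
  -- integrable. If `φ ≥ q₀`, it dominates a multiple of the integrand of the second Feller
  -- integral.
  have hd : ∀ y, 1 ≤ y → HasDerivAt
      (fun y => -(D.scale y * D.fluxPhi φ ψ y) - φ y / wronskian φ ψ)
      (D.scale y * (D.r y * D.capPhi φ ψ y)) y := by
    intro y hy
    have h := (((hD.hasDerivAt_scale (pos hy)).mul (hD.hasDerivAt_fluxPhi (pos hy))).neg).sub
      ((hD.hasDerivAt_φ (pos hy)).div_const (wronskian φ ψ))
    refine h.congr_deriv ?_
    have h1 : deriv φ y / wronskian φ ψ = -(D.scaleDeriv y * D.fluxPhi φ ψ y) := by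
      rw [hD.deriv_φ_eq (ψ := ψ) (x := y), div_eq_iff hC.ne']
      ring
    rw [h1]
    ring
  have hV := integrableOn_Ioi_deriv_of_bddAbove (m := 0) (a := 1) hd hnn
    (fun y hy => by
      have h1 := mul_nonneg (hP0 y hy) (hD.fluxPhi_pos (pos hy)).le
      have h2 := div_pos (hD.fundamental.φ_pos y (pos hy)) hC
      linarith)
  refine setLIntegral_ne_top_of_le_integrableOn (f := fun y => ENNReal.ofReal (D.speedDensity y) *
      ENNReal.ofReal (D.scale y - D.scale 1)) measurableSet_Ioi
    (hV.const_mul (wronskian φ ψ / (r₀ * q₀))) ?_ ?_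
  · intro y hy
    have hy := le_of_lt (mem_Ioi.1 hy)
    have h1 : D.scale 1 = 0 := by simp [scale]
    have hw := hD.speedDensity_pos (pos hy)
    rw [h1, sub_zero, ← ENNReal.ofReal_mul hw.le]
    refine ENNReal.ofReal_le_ofReal ?_
    have h2 : r₀ * q₀ ≤ D.r y * φ y :=
      mul_le_mul (hr y (pos hy).le) (hge y hy) hq.le (hD.r_pos' (pos hy)).le
    have h3 := mul_le_mul_of_nonneg_right h2 (mul_nonneg hw.le (hP0 y hy))
    rw [capPhi_eq, div_mul_eq_mul_div, le_div_iff₀ (mul_pos hr₀ hq)]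
    have : wronskian φ ψ * (D.scale y * (D.r y * (φ y * D.speedDensity y / wronskian φ ψ))) =
      D.r y * φ y * (D.speedDensity y * D.scale y) := by field_simp
    rw [this]
    linarith
  · rw [← hD.setLIntegral_speed]
    exact hD.infty_natural.2

end StandingAssumptions

end Data

end ImpulseControl

/-! ### The resolvent of `Θ` and the sign of the derivative of `g` -/

namespace ImpulseControl

theorem intervalIntegrable_of_continuousOn {f : ℝ → ℝ} (hf : ContinuousOn f (Ioi 0)) {a b : ℝ}
    (ha : 0 < a) (hab : a ≤ b) : IntervalIntegrable f volume a b := by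
  refine (hf.mono fun y hy => ?_).intervalIntegrable
  rw [uIcc_of_le hab] at hy
  exact ha.trans_le hy.1

namespace Data

variable (D : Data)

/-- The quotient `Θ / r`. -/
noncomputable def theta (x : ℝ) : ℝ := D.Theta x / D.r x

section Integrals

variable (φ ψ : ℝ → ℝ)

/-- The integral `∫_0^x Θ Ψ ds`. -/
noncomputable def lowerInt (x : ℝ) : ℝ := ∫ s in (0 : ℝ)..x, D.Theta s * D.capPsi φ ψ s

/-- The integral `∫_x^∞ Θ Φ ds`. -/
noncomputable def upperInt (x : ℝ) : ℝ := ∫ s in Ioi x, D.Theta s * D.capPhi φ ψ s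

/-- The function `∫_0^x (Θ(s)/r(s) - Θ(x)/r(x)) r(s) Ψ(s) ds`, which carries the sign of the
derivative of `R_Θ' / ψ'`. -/
noncomputable def slope (x : ℝ) : ℝ := D.lowerInt φ ψ x - D.theta x * D.fluxPsi φ ψ x

end Integrals

namespace StandingAssumptions

variable {D} {φ ψ : ℝ → ℝ} {ξ : ℝ} (hD : D.StandingAssumptions φ ψ ξ)

include hD

theorem fluxPsi_continuousOn : ContinuousOn (D.fluxPsi φ ψ) (Ioi 0) := fun _ hx =>
  (hD.hasDerivAt_fluxPsi hx).continuousAt.continuousWithinAt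

theorem fluxPhi_continuousOn : ContinuousOn (D.fluxPhi φ ψ) (Ioi 0) := fun _ hx =>
  (hD.hasDerivAt_fluxPhi hx).continuousAt.continuousWithinAt

theorem fluxPsi_mono : StrictMonoOn (D.fluxPsi φ ψ) (Ioi 0) := by
  refine strictMonoOn_of_deriv_pos (convex_Ioi 0) hD.fluxPsi_continuousOn ?_
  rw [interior_Ioi]
  exact fun x hx => (hD.hasDerivAt_fluxPsi hx).deriv ▸ mul_pos (hD.r_pos' hx) (hD.capPsi_pos hx)

theorem fluxPhi_anti : StrictAntiOn (D.fluxPhi φ ψ) (Ioi 0) := by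
  refine strictAntiOn_of_deriv_neg (convex_Ioi 0) hD.fluxPhi_continuousOn ?_
  rw [interior_Ioi]
  exact fun x hx => (hD.hasDerivAt_fluxPhi hx).deriv ▸
    neg_neg_of_pos (mul_pos (hD.r_pos' hx) (hD.capPhi_pos hx))

theorem fluxPsi_tendsto : Tendsto (D.fluxPsi φ ψ) (𝓝[>] 0) (𝓝 0) := by
  refine tendsto_order.2 ⟨fun a ha => ?_, fun a ha => ?_⟩
  · filter_upwards [self_mem_nhdsWithin] with x hx
    exact ha.trans (hD.fluxPsi_pos hx)
  · obtain ⟨x, hx, hxa⟩ := hD.exists_fluxPsi_lt ha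
    filter_upwards [Ioc_mem_nhdsGT hx.1] with y hy
    exact (hD.fluxPsi_mono.monotoneOn hy.1 hx.1 hy.2).trans_lt hxa

theorem fluxPhi_tendsto : Tendsto (D.fluxPhi φ ψ) atTop (𝓝 0) := by
  refine tendsto_order.2 ⟨fun a ha => ?_, fun a ha => ?_⟩
  · filter_upwards [eventually_gt_atTop 0] with x hx
    exact ha.trans (hD.fluxPhi_pos hx)
  · obtain ⟨x, hx, hxa⟩ := hD.exists_fluxPhi_lt ha
    have hx0 : 0 < x := one_pos.trans_le hx
    filter_upwards [eventually_ge_atTop x] with y hy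
    exact (hD.fluxPhi_anti.antitoneOn hx0 (hx0.trans_le hy) hy).trans_lt hxa

theorem φ_tendsto : Tendsto φ atTop (𝓝 0) := by
  refine tendsto_order.2 ⟨fun a ha => ?_, fun a ha => ?_⟩
  · filter_upwards [eventually_gt_atTop 0] with x hx
    exact ha.trans (hD.fundamental.φ_pos x hx)
  · obtain ⟨x, hx, hxa⟩ := hD.exists_φ_lt ha
    have hx0 : 0 < x := one_pos.trans_le hx
    filter_upwards [eventually_ge_atTop x] with y hy
    exact (hD.φ_strictAntiOn.antitoneOn hx0 (hx0.trans_le hy) hy).trans_lt hxa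

theorem integrableOn_r_capPsi {x : ℝ} (hx : 0 < x) :
    IntegrableOn (fun s => D.r s * D.capPsi φ ψ s) (Ioc 0 x) :=
  integrableOn_deriv_of_nonneg_of_bddBelow (fun _ hs => hD.hasDerivAt_fluxPsi hs)
    (fun _ hs => (mul_pos (hD.r_pos' hs.1) (hD.capPsi_pos hs.1)).le)
    (fun _ hs => (hD.fluxPsi_pos hs.1).le) hx

theorem integral_r_capPsi {x : ℝ} (hx : 0 < x) :
    ∫ s in (0 : ℝ)..x, D.r s * D.capPsi φ ψ s = D.fluxPsi φ ψ x := by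
  have h := intervalIntegral.integral_eq_sub_of_hasDerivAt_of_tendsto hx
    (fun s hs => hD.hasDerivAt_fluxPsi hs.1)
    ((intervalIntegrable_iff_integrableOn_Ioc_of_le hx.le).2 (hD.integrableOn_r_capPsi hx))
    hD.fluxPsi_tendsto
    ((hD.hasDerivAt_fluxPsi hx).continuousAt.tendsto.mono_left nhdsWithin_le_nhds)
  rw [h, sub_zero]

theorem integrableOn_r_capPhi {x : ℝ} (hx : 0 < x) :
    IntegrableOn (fun s => D.r s * D.capPhi φ ψ s) (Ioi x) :=
  integrableOn_Ioi_deriv_of_bddAbove (V := fun s => -D.fluxPhi φ ψ s) (m := 0)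
    (fun _ hs => (hD.hasDerivAt_fluxPhi (hx.trans_le hs)).neg.congr_deriv (neg_neg _))
    (fun _ hs => (mul_pos (hD.r_pos' (hx.trans_le hs)) (hD.capPhi_pos (hx.trans_le hs))).le)
    (fun _ hs => neg_nonpos.2 (hD.fluxPhi_pos (hx.trans_le hs)).le)

theorem integral_r_capPhi {x : ℝ} (hx : 0 < x) :
    ∫ s in Ioi x, D.r s * D.capPhi φ ψ s = D.fluxPhi φ ψ x := by
  have h := integral_Ioi_of_hasDerivAt_of_tendsto' (f := fun s => -D.fluxPhi φ ψ s)
    (fun s hs => (hD.hasDerivAt_fluxPhi (hx.trans_le hs)).neg.congr_deriv (neg_neg _))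
    (hD.integrableOn_r_capPhi hx) hD.fluxPhi_tendsto.neg
  rw [h]
  ring

theorem Theta_integrable : D.ResolventIntegrable φ ψ D.Theta := by
  intro x hx
  have h1 := hD.h_int x hx
  have h2 := hD.Lk_int x hx
  refine ⟨(h1.1.add h2.1).congr ?_, (h1.2.add h2.2).congr ?_⟩ <;>
  exact Eventually.of_forall fun s => by simp only [Pi.add_apply, Theta]; ring

theorem Theta_capPsi_continuousOn :
    ContinuousOn (fun s => D.Theta s * D.capPsi φ ψ s) (Ioi 0) :=
  hD.Θ_cont.mul hD.capPsi_continuousOn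

theorem Theta_capPhi_continuousOn :
    ContinuousOn (fun s => D.Theta s * D.capPhi φ ψ s) (Ioi 0) :=
  hD.Θ_cont.mul hD.capPhi_continuousOn

theorem theta_continuousOn : ContinuousOn D.theta (Ioi 0) :=
  hD.Θ_cont.div hD.r_continuousOn fun _ hx => (hD.r_pos' hx).ne'

theorem Theta_eq {x : ℝ} (hx : 0 < x) : D.Theta x = D.theta x * D.r x :=
  (div_mul_cancel₀ _ (hD.r_pos' hx).ne').symm

theorem intervalIntegrable_Theta_capPsi {x : ℝ} (hx : 0 < x) :
    IntervalIntegrable (fun s => D.Theta s * D.capPsi φ ψ s) volume 0 x :=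
  (intervalIntegrable_iff_integrableOn_Ioc_of_le hx.le).2 (hD.Theta_integrable x hx).1

theorem hasDerivAt_lowerInt {x : ℝ} (hx : 0 < x) :
    HasDerivAt (D.lowerInt φ ψ) (D.Theta x * D.capPsi φ ψ x) x :=
  intervalIntegral.integral_hasDerivAt_right (hD.intervalIntegrable_Theta_capPsi hx)
    (hD.Theta_capPsi_continuousOn.stronglyMeasurableAtFilter isOpen_Ioi x hx)
    (hD.Theta_capPsi_continuousOn.continuousAt (Ioi_mem_nhds hx))

theorem upperInt_eq {x : ℝ} (hx : 0 < x) : D.upperInt φ ψ x =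
    D.upperInt φ ψ 1 - ∫ s in (1 : ℝ)..x, D.Theta s * D.capPhi φ ψ s := by
  have := intervalIntegral.integral_interval_add_Ioi (hD.Theta_integrable 1 one_pos).2
    (hD.Theta_integrable x hx).2
  unfold upperInt
  linarith

theorem hasDerivAt_upperInt {x : ℝ} (hx : 0 < x) :
    HasDerivAt (D.upperInt φ ψ) (-(D.Theta x * D.capPhi φ ψ x)) x := by
  have h := (hasDerivAt_integral_of_continuousOn hD.Theta_capPhi_continuousOn one_pos hx).const_sub
    (D.upperInt φ ψ 1)
  refine h.congr_of_eventuallyEq ?_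
  filter_upwards [Ioi_mem_nhds hx] with y hy using hD.upperInt_eq hy

omit hD in
theorem resolvent_eq (x : ℝ) : D.resolvent φ ψ D.Theta x =
    φ x * D.lowerInt φ ψ x + ψ x * D.upperInt φ ψ x := rfl

theorem hasDerivAt_resolvent {x : ℝ} (hx : 0 < x) : HasDerivAt (D.resolvent φ ψ D.Theta)
    (deriv φ x * D.lowerInt φ ψ x + deriv ψ x * D.upperInt φ ψ x) x := by
  have h := ((hD.hasDerivAt_φ hx).mul (hD.hasDerivAt_lowerInt hx)).add
    ((hD.hasDerivAt_ψ hx).mul (hD.hasDerivAt_upperInt hx))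
  refine h.congr_deriv ?_
  rw [capPsi_eq, capPhi_eq]
  ring

theorem ratio_eq {x : ℝ} (hx : 0 < x) : D.ratio φ ψ x =
    D.upperInt φ ψ x - D.fluxPhi φ ψ x / D.fluxPsi φ ψ x * D.lowerInt φ ψ x := by
  have hψ := (hD.fundamental.ψ_deriv x hx).ne'
  have hp := (D.scaleDeriv_pos x).ne'
  have hC := hD.wronskian_pos.ne'
  rw [ratio, (hD.hasDerivAt_resolvent hx).deriv]
  unfold fluxPhi fluxPsi
  field_simp
  ring

theorem hasDerivAt_resolvent' {x : ℝ} (hx : 0 < x) :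
    HasDerivAt (D.resolvent φ ψ D.Theta) (D.ratio φ ψ x * deriv ψ x) x := by
  refine (hD.hasDerivAt_resolvent hx).congr_deriv ?_
  rw [ratio, (hD.hasDerivAt_resolvent hx).deriv, div_mul_cancel₀ _
    (hD.fundamental.ψ_deriv x hx).ne']

theorem hasDerivAt_ratio {x : ℝ} (hx : 0 < x) : HasDerivAt (D.ratio φ ψ)
    (D.r x * D.speedDensity x / (wronskian φ ψ * D.fluxPsi φ ψ x ^ 2) * D.slope φ ψ x) x := by
  have hq := (hD.fluxPsi_pos hx).ne'
  have hC := hD.wronskian_pos.ne'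
  have h := (hD.hasDerivAt_upperInt hx).sub (((hD.hasDerivAt_fluxPhi hx).div
    (hD.hasDerivAt_fluxPsi hx) hq).mul (hD.hasDerivAt_lowerInt hx))
  have heq : D.ratio φ ψ =ᶠ[𝓝 x]
      D.upperInt φ ψ - D.fluxPhi φ ψ / D.fluxPsi φ ψ * D.lowerInt φ ψ := by
    filter_upwards [Ioi_mem_nhds hx] with y hy using hD.ratio_eq hy
  refine (h.congr_of_eventuallyEq heq).congr_deriv ?_
  have hid := hD.flux_identity hx
  rw [capPsi_eq, capPhi_eq, slope, hD.Theta_eq hx]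
  simp only [Pi.div_apply]
  field_simp
  linear_combination D.r x * D.speedDensity x *
    (D.lowerInt φ ψ x - D.fluxPsi φ ψ x * D.theta x) * hid

theorem deriv_ratio_factor_pos {x : ℝ} (hx : 0 < x) :
    0 < D.r x * D.speedDensity x / (wronskian φ ψ * D.fluxPsi φ ψ x ^ 2) :=
  div_pos (mul_pos (hD.r_pos' hx) (hD.speedDensity_pos hx))
    (mul_pos hD.wronskian_pos (pow_pos (hD.fluxPsi_pos hx) 2))

theorem deriv_ratio_neg_iff {x : ℝ} (hx : 0 < x) :
    deriv (D.ratio φ ψ) x < 0 ↔ D.slope φ ψ x < 0 := by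
  rw [(hD.hasDerivAt_ratio hx).deriv, ← neg_pos, ← mul_neg,
    mul_pos_iff_of_pos_left (hD.deriv_ratio_factor_pos hx), neg_pos]

theorem deriv_ratio_pos_iff {x : ℝ} (hx : 0 < x) :
    0 < deriv (D.ratio φ ψ) x ↔ 0 < D.slope φ ψ x := by
  rw [(hD.hasDerivAt_ratio hx).deriv, mul_pos_iff_of_pos_left (hD.deriv_ratio_factor_pos hx)]

theorem theta_tendsto_ξ : Tendsto D.theta (𝓝 ξ) (𝓝 (D.theta ξ)) :=
  hD.theta_continuousOn.continuousAt (Ioi_mem_nhds hD.ξ_pos)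

/-- Continuity extends monotonicity to `ξ`; comparing through a midpoint keeps it strict. -/
theorem theta_strictMonoOn : StrictMonoOn D.theta (Ioc 0 ξ) := by
  intro x hx y hy hxy
  rcases hy.2.eq_or_lt with rfl | hyξ
  · have hm : (x + y) / 2 ∈ Ioo 0 y := ⟨by linarith [hx.1, hy.1], by linarith⟩
    refine (hD.Θ_incr ⟨hx.1, hxy⟩ hm (by linarith)).trans_le ?_
    refine ge_of_tendsto (hD.theta_tendsto_ξ.mono_left (nhdsWithin_le_nhds (s := Iio y))) ?_
    filter_upwards [Ioo_mem_nhdsLT hm.2] with z hz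
    exact (hD.Θ_incr hm ⟨hm.1.trans hz.1, hz.2⟩ hz.1).le
  · exact hD.Θ_incr ⟨hx.1, hxy.trans hyξ⟩ ⟨hy.1, hyξ⟩ hxy

theorem theta_strictAntiOn : StrictAntiOn D.theta (Ici ξ) := by
  intro x hx y hy hxy
  rcases (mem_Ici.1 hx).eq_or_lt with rfl | hxξ
  · have hm : ξ < (ξ + y) / 2 := by linarith
    refine (hD.Θ_decr hm (mem_Ioi.2 hxy) (by linarith)).trans_le ?_
    refine ge_of_tendsto (hD.theta_tendsto_ξ.mono_left (nhdsWithin_le_nhds (s := Ioi ξ))) ?_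
    filter_upwards [Ioo_mem_nhdsGT hm] with z hz
    exact (hD.Θ_decr hz.1 hm hz.2).le
  · exact hD.Θ_decr hxξ (hxξ.trans hxy) hxy

theorem slope_neg {x : ℝ} (hx : 0 < x) (hxξ : x ≤ ξ) : D.slope φ ψ x < 0 := by
  have hr := (intervalIntegrable_iff_integrableOn_Ioc_of_le hx.le).2
    (hD.integrableOn_r_capPsi (x := x) hx)
  have hΘ := hD.intervalIntegrable_Theta_capPsi hx
  have h := intervalIntegral.intervalIntegral_pos_of_pos_on ((hr.const_mul (D.theta x)).sub hΘ)
    (fun s hs => by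
      have h1 := hD.theta_strictMonoOn ⟨hs.1, hs.2.le.trans hxξ⟩ ⟨hx, hxξ⟩ hs.2
      have h2 := mul_pos (hD.r_pos' hs.1) (hD.capPsi_pos hs.1)
      rw [hD.Theta_eq hs.1]
      nlinarith [mul_pos (sub_pos.2 h1) h2]) hx
  rw [intervalIntegral.integral_sub (hr.const_mul _) hΘ, intervalIntegral.integral_const_mul,
    hD.integral_r_capPsi hx] at h
  unfold slope lowerInt
  linarith

theorem lowerInt_sub {a x : ℝ} (ha : 0 < a) (hx : a ≤ x) : D.lowerInt φ ψ x - D.lowerInt φ ψ a =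
    ∫ s in a..x, D.Theta s * D.capPsi φ ψ s :=
  intervalIntegral.integral_interval_sub_left
    (hD.intervalIntegrable_Theta_capPsi (ha.trans_le hx)) (hD.intervalIntegrable_Theta_capPsi ha)

theorem fluxPsi_sub {a x : ℝ} (ha : 0 < a) (hx : a ≤ x) : D.fluxPsi φ ψ x - D.fluxPsi φ ψ a =
    ∫ s in a..x, D.r s * D.capPsi φ ψ s := by
  rw [← hD.integral_r_capPsi ha, ← hD.integral_r_capPsi (ha.trans_le hx)]
  exact intervalIntegral.integral_interval_sub_left
    ((intervalIntegrable_iff_integrableOn_Ioc_of_le (ha.trans_le hx).le).2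
      (hD.integrableOn_r_capPsi (ha.trans_le hx)))
    ((intervalIntegrable_iff_integrableOn_Ioc_of_le ha.le).2 (hD.integrableOn_r_capPsi ha))

theorem lowerInt_sub_ge {a x m : ℝ} (ha : 0 < a) (hx : a ≤ x)
    (h : ∀ s ∈ Icc a x, m ≤ D.theta s) :
    m * (D.fluxPsi φ ψ x - D.fluxPsi φ ψ a) ≤ D.lowerInt φ ψ x - D.lowerInt φ ψ a := by
  rw [hD.lowerInt_sub ha hx, hD.fluxPsi_sub ha hx, ← intervalIntegral.integral_const_mul]
  refine intervalIntegral.integral_mono_on hx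
    ((intervalIntegrable_of_continuousOn (hD.r_continuousOn.mul hD.capPsi_continuousOn)
      ha hx).const_mul m)
    (intervalIntegrable_of_continuousOn hD.Theta_capPsi_continuousOn ha hx) fun s hs => ?_
  have hs0 := ha.trans_le hs.1
  rw [hD.Theta_eq hs0, mul_assoc]
  exact mul_le_mul_of_nonneg_right (h s hs) (mul_pos (hD.r_pos' hs0) (hD.capPsi_pos hs0)).le

theorem lowerInt_sub_le {a x m : ℝ} (ha : 0 < a) (hx : a ≤ x)
    (h : ∀ s ∈ Icc a x, D.theta s ≤ m) :
    D.lowerInt φ ψ x - D.lowerInt φ ψ a ≤ m * (D.fluxPsi φ ψ x - D.fluxPsi φ ψ a) := by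
  rw [hD.lowerInt_sub ha hx, hD.fluxPsi_sub ha hx, ← intervalIntegral.integral_const_mul]
  refine intervalIntegral.integral_mono_on hx
    (intervalIntegrable_of_continuousOn hD.Theta_capPsi_continuousOn ha hx)
    ((intervalIntegrable_of_continuousOn (hD.r_continuousOn.mul hD.capPsi_continuousOn)
      ha hx).const_mul m) fun s hs => ?_
  have hs0 := ha.trans_le hs.1
  rw [hD.Theta_eq hs0, mul_assoc]
  exact mul_le_mul_of_nonneg_right (h s hs) (mul_pos (hD.r_pos' hs0) (hD.capPsi_pos hs0)).le

theorem le_upperInt {x m : ℝ} (hx : 0 < x) (h : ∀ s, x ≤ s → m ≤ D.theta s) :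
    m * D.fluxPhi φ ψ x ≤ D.upperInt φ ψ x := by
  rw [← hD.integral_r_capPhi hx, ← integral_const_mul]
  refine setIntegral_mono_on ((hD.integrableOn_r_capPhi hx).const_mul m)
    (hD.Theta_integrable x hx).2 measurableSet_Ioi fun s hs => ?_
  have hs0 : 0 < s := hx.trans hs
  rw [hD.Theta_eq hs0, mul_assoc]
  exact mul_le_mul_of_nonneg_right (h s (le_of_lt hs))
    (mul_pos (hD.r_pos' hs0) (hD.capPhi_pos hs0)).le

theorem upperInt_le {x m : ℝ} (hx : 0 < x) (h : ∀ s, x ≤ s → D.theta s ≤ m) :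
    D.upperInt φ ψ x ≤ m * D.fluxPhi φ ψ x := by
  rw [← hD.integral_r_capPhi hx, ← integral_const_mul]
  refine setIntegral_mono_on (hD.Theta_integrable x hx).2
    ((hD.integrableOn_r_capPhi hx).const_mul m) measurableSet_Ioi fun s hs => ?_
  have hs0 : 0 < s := hx.trans hs
  rw [hD.Theta_eq hs0, mul_assoc]
  exact mul_le_mul_of_nonneg_right (h s (le_of_lt hs))
    (mul_pos (hD.r_pos' hs0) (hD.capPhi_pos hs0)).le

/-- Beyond `a`, `Θ` is compared with `m r`, whose resolvent is the constant `m`. What happens on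
`]0,a]` only contributes a multiple of `φ x`. -/
theorem le_resolvent {a x m : ℝ} (ha : 0 < a) (hx : a ≤ x) (h : ∀ s, a ≤ s → m ≤ D.theta s) :
    φ x * (D.lowerInt φ ψ a - m * D.fluxPsi φ ψ a) + m ≤ D.resolvent φ ψ D.Theta x := by
  have hx0 := ha.trans_le hx
  have h1 := mul_le_mul_of_nonneg_left (hD.lowerInt_sub_ge ha hx fun s hs => h s hs.1)
    (hD.fundamental.φ_pos x hx0).le
  have h2 := mul_le_mul_of_nonneg_left (hD.le_upperInt hx0 fun s hs => h s (hx.trans hs))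
    (hD.fundamental.ψ_pos x hx0).le
  rw [resolvent_eq]
  linear_combination h1 + h2 - m * hD.flux_identity hx0

theorem resolvent_le {a x m : ℝ} (ha : 0 < a) (hx : a ≤ x) (h : ∀ s, a ≤ s → D.theta s ≤ m) :
    D.resolvent φ ψ D.Theta x ≤ φ x * (D.lowerInt φ ψ a - m * D.fluxPsi φ ψ a) + m := by
  have hx0 := ha.trans_le hx
  have h1 := mul_le_mul_of_nonneg_left (hD.lowerInt_sub_le ha hx fun s hs => h s hs.1)
    (hD.fundamental.φ_pos x hx0).le
  have h2 := mul_le_mul_of_nonneg_left (hD.upperInt_le hx0 fun s hs => h s (hx.trans hs))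
    (hD.fundamental.ψ_pos x hx0).le
  rw [resolvent_eq]
  linear_combination h1 + h2 + m * hD.flux_identity hx0

/-- Since `θ` is only continuous, increments are estimated directly: bounding `θ` below by `θ y` on
`[x,y]` leaves an increment of at least `(θ x - θ y)` times the flux at `x`. -/
theorem slope_strictMonoOn : StrictMonoOn (D.slope φ ψ) (Ici ξ) := by
  intro x hx y hy hxy
  have hx0 := hD.ξ_pos.trans_le hx
  have h1 := hD.lowerInt_sub_ge hx0 hxy.le (m := D.theta y) fun s hs =>
    hD.theta_strictAntiOn.antitoneOn (mem_Ici.2 (le_trans hx hs.1)) hy hs.2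
  have h2 := mul_pos (sub_pos.2 (hD.theta_strictAntiOn hx hy hxy)) (hD.fluxPsi_pos hx0)
  unfold slope
  linarith

theorem slope_continuousOn : ContinuousOn (D.slope φ ψ) (Ioi 0) :=
  ContinuousOn.sub (fun _ hx => (hD.hasDerivAt_lowerInt hx).continuousAt.continuousWithinAt)
    (hD.theta_continuousOn.mul hD.fluxPsi_continuousOn)

theorem existsUnique_lowerPoint : ∃! xl : EReal, D.IsLowerPoint φ ψ ξ xl := by
  have huniq : ∀ a b : EReal, D.IsLowerPoint φ ψ ξ a → D.IsLowerPoint φ ψ ξ b → b ≤ a := by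
    intro a b ha hb
    by_contra! hlt
    obtain ⟨x, hx1, hx2⟩ := EReal.lt_iff_exists_real_btwn.1 hlt
    have hx0 : 0 < x := hD.ξ_pos.trans (EReal.coe_lt_coe_iff.1 (ha.1.trans hx1))
    exact ((ha.2 x hx0).2 hx1).not_gt ((hb.2 x hx0).1 hx2)
  -- Taking the supremum in `EReal` includes the case where the slope never becomes positive.
  have hex : D.IsLowerPoint φ ψ ξ
      (sSup ((fun x : ℝ => (x : EReal)) '' {x | 0 < x ∧ D.slope φ ψ x < 0})) := by
    have hlt : (ξ : EReal) <
        sSup ((fun x : ℝ => (x : EReal)) '' {x | 0 < x ∧ D.slope φ ψ x < 0}) := by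
      have hc : Tendsto (D.slope φ ψ) (𝓝[>] ξ) (𝓝 (D.slope φ ψ ξ)) :=
        (hD.slope_continuousOn.continuousAt (Ioi_mem_nhds hD.ξ_pos)).tendsto.mono_left
          nhdsWithin_le_nhds
      obtain ⟨y, hy, hyξ⟩ := ((hc.eventually (gt_mem_nhds (hD.slope_neg hD.ξ_pos le_rfl))).and
        self_mem_nhdsWithin).exists
      exact (EReal.coe_lt_coe_iff.2 hyξ).trans_le
        (le_sSup (mem_image_of_mem _ ⟨hD.ξ_pos.trans hyξ, hy⟩))
    refine ⟨hlt, fun x hx => ⟨fun h => ?_, fun h => ?_⟩⟩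
    · rw [hD.deriv_ratio_neg_iff hx]
      obtain ⟨_, ⟨y, hy, rfl⟩, hxy⟩ := lt_sSup_iff.1 h
      have hxy := EReal.coe_lt_coe_iff.1 hxy
      rcases le_total x ξ with hxξ | hxξ
      · exact hD.slope_neg hx hxξ
      · exact (hD.slope_strictMonoOn hxξ (hxξ.trans hxy.le) hxy).trans hy.2
    · rw [hD.deriv_ratio_pos_iff hx]
      obtain ⟨z, hz1, hz2⟩ := EReal.lt_iff_exists_real_btwn.1 h
      have hzξ : ξ < z := EReal.coe_lt_coe_iff.1 (hlt.trans hz1)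
      have hzx : z < x := EReal.coe_lt_coe_iff.1 hz2
      have hz : 0 ≤ D.slope φ ψ z := by
        by_contra! hneg
        exact hz1.not_ge (le_sSup (mem_image_of_mem _ ⟨hD.ξ_pos.trans hzξ, hneg⟩))
      exact hz.trans_lt (hD.slope_strictMonoOn hzξ.le (hzξ.trans hzx).le hzx)
  exact ⟨_, hex, fun y hy => le_antisymm (huniq _ _ hex hy) (huniq _ _ hy hex)⟩

/-! ### Behaviour at infinity -/

theorem exists_theta_lim :
    ∃ θ₁ : EReal, Tendsto (fun x => (D.theta x : EReal)) atTop (𝓝 θ₁) := by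
  refine ⟨sInf ((fun x => (D.theta x : EReal)) '' Ici ξ),
    tendsto_order.2 ⟨fun a ha => ?_, fun a ha => ?_⟩⟩
  · filter_upwards [eventually_ge_atTop ξ] with x hx
    exact ha.trans_le (sInf_le (mem_image_of_mem (fun x => (D.theta x : EReal)) hx))
  · obtain ⟨_, ⟨x, hx, rfl⟩, hxa⟩ := sInf_lt_iff.1 ha
    filter_upwards [eventually_ge_atTop x] with y hy
    exact (EReal.coe_le_coe_iff.2 (hD.theta_strictAntiOn.antitoneOn hx
      (le_trans (mem_Ici.1 hx) hy) hy)).trans_lt hxa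

theorem resolvent_bddBelow_iff {xl : ℝ} (hxl : ξ < xl) {θ₁ : EReal}
    (hθ : Tendsto (fun x => (D.theta x : EReal)) atTop (𝓝 θ₁)) :
    (∃ M, ∀ x, xl < x → M ≤ D.resolvent φ ψ D.Theta x) ↔ ⊥ < θ₁ := by
  constructor
  · rintro ⟨M, hM⟩
    by_contra! hbot
    rw [le_bot_iff] at hbot
    subst hbot
    obtain ⟨a, ha⟩ := ((hθ.eventually (gt_mem_nhds (EReal.bot_lt_coe (M - 1)))).and
      (eventually_gt_atTop 0)).exists_forall_of_atTop
    -- If `θ` fell below `M - 1` for good, the upper bound on the resolvent would tend to `M - 1`,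
    -- contradicting the lower bound `M`.
    have hlim : Tendsto (fun x => φ x * (D.lowerInt φ ψ a - (M - 1) * D.fluxPsi φ ψ a) + (M - 1))
        atTop (𝓝 (0 * (D.lowerInt φ ψ a - (M - 1) * D.fluxPsi φ ψ a) + (M - 1))) :=
      (hD.φ_tendsto.mul_const _).add_const _
    have := ge_of_tendsto hlim (by
      filter_upwards [eventually_gt_atTop xl, eventually_ge_atTop a] with x hx hxa
      exact (hM x hx).trans (hD.resolvent_le (ha a le_rfl).2 hxa fun s hs =>
        (EReal.coe_lt_coe_iff.1 (ha s hs).1).le))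
    linarith
  · intro hbot
    obtain ⟨m, -, hm⟩ := EReal.lt_iff_exists_real_btwn.1 hbot
    have hmθ : ∀ s, ξ ≤ s → m ≤ D.theta s := by
      intro s hs
      obtain ⟨y, hy, hys⟩ := ((hθ.eventually (lt_mem_nhds hm)).and (eventually_ge_atTop s)).exists
      exact (EReal.coe_lt_coe_iff.1 hy).le.trans
        (hD.theta_strictAntiOn.antitoneOn hs (hs.trans hys) hys)
    set c := D.lowerInt φ ψ ξ - m * D.fluxPsi φ ψ ξ with hc
    refine ⟨-(φ ξ * |c|) + m, fun x hx => ?_⟩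
    have hx0 := hD.ξ_pos.trans (hxl.trans hx)
    refine le_trans ?_ (hD.le_resolvent hD.ξ_pos (hxl.trans hx).le hmθ)
    have h1 : φ x ≤ φ ξ := hD.φ_strictAntiOn.antitoneOn hD.ξ_pos hx0 (hxl.trans hx).le
    have h2 := mul_le_mul_of_nonneg_right h1 (abs_nonneg c)
    have h3 := mul_le_mul_of_nonneg_left (neg_abs_le c) (hD.fundamental.φ_pos x hx0).le
    linarith

/-- For `s ≤ x` one has `(φ x / ψ x) Ψ(s) ≤ Φ(s)`. So the part of the lower integral beyond `N`,
together with the upper integral, is at most `∫_N^∞ |Θ|Φ`; the remaining part carries the factor `φ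
x / ψ x → 0`. -/
theorem resolvent_div_ψ_tendsto :
    Tendsto (fun x => D.resolvent φ ψ D.Theta x / ψ x) atTop (𝓝 0) := by
  set E : ℝ → ℝ := fun N => ∫ s in Ioi N, |D.Theta s * D.capPhi φ ψ s| with hE
  have hint : ∀ N, 0 < N → IntegrableOn (fun s => |D.Theta s * D.capPhi φ ψ s|) (Ioi N) :=
    fun N hN => (hD.Theta_integrable N hN).2.abs
  have hsplit : ∀ N x, 0 < N → N ≤ x →
      (∫ s in N..x, |D.Theta s * D.capPhi φ ψ s|) + E x = E N := fun N x hN hx =>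
    intervalIntegral.integral_interval_add_Ioi (hint N hN) (hint x (hN.trans_le hx))
  have hE0 : ∀ N, 0 ≤ E N := fun N => integral_nonneg fun s => abs_nonneg _
  have hElim : Tendsto E atTop (𝓝 0) := by
    have h := (intervalIntegral_tendsto_integral_Ioi 1 (hint 1 one_pos) tendsto_id).const_sub (E 1)
    rw [sub_self] at h
    refine h.congr' ?_
    filter_upwards [eventually_ge_atTop 1] with x hx
    simp only [id, ← hsplit 1 x one_pos hx, add_sub_cancel_left]
  have hbound : ∀ N x, 0 < N → N ≤ x → |D.resolvent φ ψ D.Theta x / ψ x| ≤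
      φ x / ψ x * |D.lowerInt φ ψ N| + E N := by
    intro N x hN hx
    have hx0 := hN.trans_le hx
    have hφ := hD.fundamental.φ_pos x hx0
    have hψ := hD.fundamental.ψ_pos x hx0
    have h1 : |D.upperInt φ ψ x| ≤ E x := abs_integral_le_integral_abs
    have h2 : |D.lowerInt φ ψ x - D.lowerInt φ ψ N| ≤
        ∫ s in N..x, ψ x / φ x * |D.Theta s * D.capPhi φ ψ s| := by
      rw [hD.lowerInt_sub hN hx, ← Real.norm_eq_abs]
      refine intervalIntegral.norm_integral_le_of_norm_le hx (Eventually.of_forall fun s hs => ?_)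
        ((intervalIntegrable_of_continuousOn hD.Theta_capPhi_continuousOn.abs
          hN hx).const_mul _)
      have hs0 : 0 < s := hN.trans hs.1
      rw [Real.norm_eq_abs, abs_mul, abs_mul, abs_of_pos (hD.capPsi_pos hs0),
        abs_of_pos (hD.capPhi_pos hs0), mul_left_comm]
      refine mul_le_mul_of_nonneg_left ?_ (abs_nonneg _)
      rw [div_mul_eq_mul_div, le_div_iff₀ hφ, capPsi_eq, capPhi_eq, div_mul_eq_mul_div,
        ← mul_div_assoc]
      refine div_le_div_of_nonneg_right ?_ hD.wronskian_pos.le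
      have h3 : φ x ≤ φ s := hD.φ_strictAntiOn.antitoneOn hs0 hx0 hs.2
      have h4 : ψ s ≤ ψ x := hD.ψ_strictMonoOn.monotoneOn hs0 hx0 hs.2
      have h5 := mul_le_mul h4 h3 hφ.le hψ.le
      have h6 := mul_le_mul_of_nonneg_right h5 (hD.speedDensity_pos hs0).le
      linarith
    rw [intervalIntegral.integral_const_mul] at h2
    have h3 := abs_sub_abs_le_abs_sub (D.lowerInt φ ψ x) (D.lowerInt φ ψ N)
    have h4 : D.resolvent φ ψ D.Theta x / ψ x =
        φ x / ψ x * D.lowerInt φ ψ x + D.upperInt φ ψ x := by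
      rw [resolvent_eq]
      field_simp
    have h5 := mul_le_mul_of_nonneg_left (h3.trans h2) (div_pos hφ hψ).le
    have h6 : φ x / ψ x * (ψ x / φ x * ∫ s in N..x, |D.Theta s * D.capPhi φ ψ s|) =
        ∫ s in N..x, |D.Theta s * D.capPhi φ ψ s| := by
      field_simp
    have h7 := hsplit N x hN hx
    have h8 := abs_add_le (φ x / ψ x * D.lowerInt φ ψ x) (D.upperInt φ ψ x)
    rw [abs_mul, abs_of_pos (div_pos hφ hψ)] at h8
    rw [h4]
    linarith
  rw [Metric.tendsto_nhds]
  intro ε hε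
  obtain ⟨N, hNε, hN⟩ := ((hElim.eventually (gt_mem_nhds (half_pos hε))).and
    (eventually_gt_atTop 0)).exists
  have hφψ : Tendsto (fun x => φ x / ψ x * |D.lowerInt φ ψ N|) atTop (𝓝 0) := by
    simpa using (hD.φ_tendsto.div_atTop hD.fundamental.ψ_infty).mul_const |D.lowerInt φ ψ N|
  filter_upwards [hφψ.eventually (gt_mem_nhds (half_pos hε)), eventually_ge_atTop N] with x h1 hx
  rw [Real.dist_eq, sub_zero]
  linarith [hbound N x hN hx]

/-- Under the hypothesis `R_Θ - δψ` is nondecreasing; dividing by `ψ → ∞` and using `R_Θ/ψ → 0`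
gives the sign of `δ`. With its counterpart it identifies the limit of the eventually monotone `g`
as `0`. -/
theorem nonpos_of_le_ratio {x₀ δ : ℝ} (hx₀ : 0 < x₀) (h : ∀ x, x₀ ≤ x → δ ≤ D.ratio φ ψ x) :
    δ ≤ 0 := by
  have hd : ∀ x, x₀ ≤ x → HasDerivAt (fun x => D.resolvent φ ψ D.Theta x - δ * ψ x)
      (D.ratio φ ψ x * deriv ψ x - δ * deriv ψ x) x := fun x hx =>
    (hD.hasDerivAt_resolvent' (hx₀.trans_le hx)).sub
      ((hD.hasDerivAt_ψ (hx₀.trans_le hx)).const_mul δ)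
  have hm : MonotoneOn (fun x => D.resolvent φ ψ D.Theta x - δ * ψ x) (Ici x₀) := by
    refine monotoneOn_of_deriv_nonneg (convex_Ici x₀)
      (fun x hx => (hd x hx).continuousAt.continuousWithinAt) ?_ ?_
    all_goals rw [interior_Ici]
    · exact fun x hx => (hd x (le_of_lt hx)).differentiableAt.differentiableWithinAt
    · intro x hx
      rw [(hd x (le_of_lt hx)).deriv, ← sub_mul]
      exact mul_nonneg (sub_nonneg.2 (h x (le_of_lt hx)))
        (hD.fundamental.ψ_deriv x (hx₀.trans hx)).le
  have hlim : Tendsto (fun x => D.resolvent φ ψ D.Theta x / ψ x -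
      (D.resolvent φ ψ D.Theta x₀ - δ * ψ x₀) / ψ x) atTop (𝓝 (0 - 0)) :=
    hD.resolvent_div_ψ_tendsto.sub (tendsto_const_nhds.div_atTop hD.fundamental.ψ_infty)
  rw [sub_zero] at hlim
  refine ge_of_tendsto hlim ?_
  filter_upwards [eventually_ge_atTop x₀] with x hx
  have h1 := hm self_mem_Ici hx hx
  rw [← sub_div, le_div_iff₀ (hD.fundamental.ψ_pos x (hx₀.trans_le hx))]
  dsimp only at h1
  linarith

theorem nonneg_of_ratio_le {x₀ δ : ℝ} (hx₀ : 0 < x₀) (h : ∀ x, x₀ ≤ x → D.ratio φ ψ x ≤ δ) :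
    0 ≤ δ := by
  have hd : ∀ x, x₀ ≤ x → HasDerivAt (fun x => D.resolvent φ ψ D.Theta x - δ * ψ x)
      (D.ratio φ ψ x * deriv ψ x - δ * deriv ψ x) x := fun x hx =>
    (hD.hasDerivAt_resolvent' (hx₀.trans_le hx)).sub
      ((hD.hasDerivAt_ψ (hx₀.trans_le hx)).const_mul δ)
  have hm : AntitoneOn (fun x => D.resolvent φ ψ D.Theta x - δ * ψ x) (Ici x₀) := by
    refine antitoneOn_of_deriv_nonpos (convex_Ici x₀)
      (fun x hx => (hd x hx).continuousAt.continuousWithinAt) ?_ ?_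
    all_goals rw [interior_Ici]
    · exact fun x hx => (hd x (le_of_lt hx)).differentiableAt.differentiableWithinAt
    · intro x hx
      rw [(hd x (le_of_lt hx)).deriv, ← sub_mul]
      exact mul_nonpos_of_nonpos_of_nonneg (sub_nonpos.2 (h x (le_of_lt hx)))
        (hD.fundamental.ψ_deriv x (hx₀.trans hx)).le
  have hlim : Tendsto (fun x => D.resolvent φ ψ D.Theta x / ψ x -
      (D.resolvent φ ψ D.Theta x₀ - δ * ψ x₀) / ψ x) atTop (𝓝 (0 - 0)) :=
    hD.resolvent_div_ψ_tendsto.sub (tendsto_const_nhds.div_atTop hD.fundamental.ψ_infty)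
  rw [sub_zero] at hlim
  refine le_of_tendsto hlim ?_
  filter_upwards [eventually_ge_atTop x₀] with x hx
  have h1 := hm self_mem_Ici hx hx
  rw [← sub_div, div_le_iff₀ (hD.fundamental.ψ_pos x (hx₀.trans_le hx))]
  dsimp only at h1
  linarith

theorem ratio_continuousOn : ContinuousOn (D.ratio φ ψ) (Ioi 0) := fun _ hx =>
  (hD.hasDerivAt_ratio hx).continuousAt.continuousWithinAt

/-! ### The relation `dG = -ψ dg` and the valley -/

theorem hasDerivAt_G {x : ℝ} (hx : 0 < x) :
    HasDerivAt (D.G φ ψ) (-(deriv (D.ratio φ ψ) x * ψ x)) x := by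
  have h := (hD.hasDerivAt_resolvent' hx).sub
    ((hD.hasDerivAt_ratio hx).differentiableAt.hasDerivAt.mul (hD.hasDerivAt_ψ hx))
  exact h.congr_deriv (by ring)

/-- The derivative of `G + c g` is `g' (c - ψ)`. Taking for `c` an endpoint value of `ψ`, or `0`,
gives the increment bounds of `Valley` without integrating `g'`. -/
theorem G_add_ratio_monotoneOn {x y c : ℝ} (hx : 0 < x)
    (h : ∀ t ∈ Ioo x y, 0 ≤ deriv (D.ratio φ ψ) t * (c - ψ t)) :
    MonotoneOn (fun t => D.G φ ψ t + c * D.ratio φ ψ t) (Icc x y) := by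
  have hd : ∀ t, x ≤ t → HasDerivAt (fun t => D.G φ ψ t + c * D.ratio φ ψ t)
      (deriv (D.ratio φ ψ) t * (c - ψ t)) t := fun t ht =>
    ((hD.hasDerivAt_G (hx.trans_le ht)).add
      ((hD.hasDerivAt_ratio (hx.trans_le ht)).differentiableAt.hasDerivAt.const_mul c)).congr_deriv
      (by ring)
  refine monotoneOn_of_deriv_nonneg (convex_Icc x y)
    (fun t ht => (hd t ht.1).continuousAt.continuousWithinAt) ?_ ?_
  all_goals rw [interior_Icc]
  · exact fun t ht => (hd t ht.1.le).differentiableAt.differentiableWithinAt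
  · exact fun t ht => (hd t ht.1.le).deriv ▸ h t ht

theorem G_add_ratio_antitoneOn {x y c : ℝ} (hx : 0 < x)
    (h : ∀ t ∈ Ioo x y, deriv (D.ratio φ ψ) t * (c - ψ t) ≤ 0) :
    AntitoneOn (fun t => D.G φ ψ t + c * D.ratio φ ψ t) (Icc x y) := by
  have hd : ∀ t, x ≤ t → HasDerivAt (fun t => D.G φ ψ t + c * D.ratio φ ψ t)
      (deriv (D.ratio φ ψ) t * (c - ψ t)) t := fun t ht =>
    ((hD.hasDerivAt_G (hx.trans_le ht)).add
      ((hD.hasDerivAt_ratio (hx.trans_le ht)).differentiableAt.hasDerivAt.const_mul c)).congr_deriv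
      (by ring)
  refine antitoneOn_of_deriv_nonpos (convex_Icc x y)
    (fun t ht => (hd t ht.1).continuousAt.continuousWithinAt) ?_ ?_
  all_goals rw [interior_Icc]
  · exact fun t ht => (hd t ht.1.le).differentiableAt.differentiableWithinAt
  · exact fun t ht => (hd t ht.1.le).deriv ▸ h t ht

theorem valley {xl : ℝ} (h : D.IsLowerPoint φ ψ ξ (xl : EReal)) :
    Valley (D.ratio φ ψ) (D.G φ ψ) ψ xl := by
  have hξ : ξ < xl := EReal.coe_lt_coe_iff.1 h.1
  have hpos : 0 < xl := hD.ξ_pos.trans hξ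
  have hneg : ∀ x, 0 < x → x < xl → deriv (D.ratio φ ψ) x < 0 := fun x hx hxl =>
    (h.2 x hx).1 (EReal.coe_lt_coe_iff.2 hxl)
  have hposd : ∀ x, xl < x → 0 < deriv (D.ratio φ ψ) x := fun x hxl =>
    (h.2 x (hpos.trans hxl)).2 (EReal.coe_lt_coe_iff.2 hxl)
  have hψ := hD.ψ_strictMonoOn.monotoneOn
  have hmono : StrictMonoOn (D.ratio φ ψ) (Ici xl) := by
    refine strictMonoOn_of_deriv_pos (convex_Ici xl)
      (hD.ratio_continuousOn.mono fun x hx => hpos.trans_le hx) ?_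
    rw [interior_Ici]
    exact fun x hx => hposd x hx
  refine ⟨hpos, hD.ratio_continuousOn, ?_, hmono, ?_, hD.ψ_strictMonoOn, ?_, ?_, ?_, ?_⟩
  · refine strictAntiOn_of_deriv_neg (convex_Ioc 0 xl)
      (hD.ratio_continuousOn.mono fun x hx => hx.1) ?_
    rw [interior_Ioc]
    exact fun x hx => hneg x hx.1 hx.2
  · refine tendsto_order.2 ⟨fun a ha => ?_, fun a ha => ?_⟩
    · obtain ⟨x, hx, hax⟩ : ∃ x, xl ≤ x ∧ a < D.ratio φ ψ x := by
        by_contra! hle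
        exact ha.not_ge (hD.nonneg_of_ratio_le hpos hle)
      filter_upwards [eventually_ge_atTop x] with y hy
      exact hax.trans_le (hmono.monotoneOn hx (hx.trans hy) hy)
    · filter_upwards [eventually_ge_atTop xl] with x hx
      by_contra! hle
      exact ha.not_ge (hD.nonpos_of_le_ratio (hpos.trans_le hx) fun y hy =>
        hle.trans (hmono.monotoneOn hx (hx.trans hy) hy))
  · intro x y hx hxy
    have hx0 := hpos.trans_le hx
    have := hD.G_add_ratio_antitoneOn (y := y) (c := ψ x) hx0 (fun t ht =>
      mul_nonpos_of_nonneg_of_nonpos (hposd t (hx.trans_lt ht.1)).le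
        (sub_nonpos.2 (hψ hx0 (hx0.trans ht.1) ht.1.le))) ⟨le_rfl, hxy⟩ ⟨hxy, le_rfl⟩ hxy
    dsimp only at this
    linarith
  · intro x y hx hxy
    have hx0 := hpos.trans_le hx
    have := hD.G_add_ratio_monotoneOn (y := y) (c := ψ y) hx0 (fun t ht =>
      mul_nonneg (hposd t (hx.trans_lt ht.1)).le
        (sub_nonneg.2 (hψ (hx0.trans ht.1) (hx0.trans_le hxy) ht.2.le)))
      ⟨le_rfl, hxy⟩ ⟨hxy, le_rfl⟩ hxy
    dsimp only at this
    linarith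
  · intro x y hx hxy hy
    have := hD.G_add_ratio_monotoneOn (y := y) (c := 0) hx (fun t ht =>
      mul_nonneg_of_nonpos_of_nonpos (hneg t (hx.trans ht.1) (ht.2.trans_le hy)).le
        (by linarith [hD.fundamental.ψ_pos t (hx.trans ht.1)])) ⟨le_rfl, hxy⟩ ⟨hxy, le_rfl⟩ hxy
    simpa using this
  · intro x y hx hxy hy
    have := hD.G_add_ratio_antitoneOn (y := y) (c := ψ y) hx (fun t ht =>
      mul_nonpos_of_nonpos_of_nonneg (hneg t (hx.trans ht.1) (ht.2.trans_le hy)).le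
        (sub_nonneg.2 (hψ (hx.trans ht.1) (hx.trans_le hxy) ht.2.le)))
      ⟨le_rfl, hxy⟩ ⟨hxy, le_rfl⟩ hxy
    dsimp only at this
    linarith

end StandingAssumptions

end Data

end ImpulseControl

/-! ### The theorem -/

theorem mainTheorem3 (D : ImpulseControl.Data) (φ ψ : ℝ → ℝ) (ξ : ℝ)
    (hD : D.StandingAssumptions φ ψ ξ) :
    (∃! xl : EReal, D.IsLowerPoint φ ψ ξ xl) ∧
    ∀ xl : ℝ, D.IsLowerPoint φ ψ ξ (xl : EReal) →
    ∃ g₀ θ₁ : EReal,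
      Tendsto (fun x => (D.ratio φ ψ x : EReal)) (𝓝[>] (0 : ℝ)) (𝓝 g₀) ∧
      Tendsto (fun x => ((D.Theta x / D.r x : ℝ) : EReal)) atTop (𝓝 θ₁) ∧
      ∃ cs : EReal, D.IsCriticalCost φ ψ xl (D.upperPoint φ ψ g₀) cs ∧ 0 < cs ∧
      ∃ γs βs : ℝ → ℝ,
        D.IsFreeBoundary φ ψ xl (D.upperPoint φ ψ g₀) cs γs βs ∧
        (∀ γ' β' : ℝ → ℝ, D.IsFreeBoundary φ ψ xl (D.upperPoint φ ψ g₀) cs γ' β' →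
          EqOn γ' γs (ImpulseControl.Data.costs cs) ∧
          EqOn β' βs (ImpulseControl.Data.costs cs)) ∧
        (∀ c γ β : ℝ, 0 < c → 0 < γ → γ < β → D.FreeBoundarySystem φ ψ c γ β →
          c ∈ ImpulseControl.Data.costs cs ∧ γ = γs c ∧ β = βs c) ∧
        Tendsto βs (𝓝[>] (0 : ℝ)) (𝓝 xl) ∧
        Tendsto γs (𝓝[>] (0 : ℝ)) (𝓝 xl) ∧
        Tendsto (fun c => (βs c : EReal)) (ImpulseControl.upTo cs)
          (𝓝 (D.upperPoint φ ψ g₀)) ∧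
        (∃ l : ℝ, Tendsto γs (ImpulseControl.upTo cs) (𝓝 l) ∧
          (0 < g₀ → D.upperPoint φ ψ g₀ = ⊤ ∧ 0 < l) ∧
          (g₀ = 0 → D.upperPoint φ ψ g₀ = ⊤ ∧ l = 0) ∧
          (g₀ < 0 → D.upperPoint φ ψ g₀ < ⊤ ∧ l = 0)) ∧
        (cs < ⊤ ↔ D.upperPoint φ ψ g₀ < ⊤ ∨ (D.upperPoint φ ψ g₀ = ⊤ ∧ ⊥ < θ₁)) := by
  refine ⟨hD.existsUnique_lowerPoint, fun xl hxl => ?_⟩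
  have V := hD.valley hxl
  obtain ⟨g₀, hg⟩ := V.exists_lim_zero
  obtain ⟨θ₁, hθ⟩ := hD.exists_theta_lim
  have hupper : D.upperPoint φ ψ g₀ = ImpulseControl.exceedPoint (D.ratio φ ψ) g₀ := rfl
  refine ⟨g₀, θ₁, hg, hθ, ImpulseControl.criticalCost (D.ratio φ ψ) (D.G φ ψ) xl
    (D.upperPoint φ ψ g₀), ?_⟩
  rw [hupper]
  have huniq := fun c γ β (_ : (0 : ℝ) < c) (h0 : 0 < γ) (h : γ < β)
    (hs : D.FreeBoundarySystem φ ψ c γ β) => V.solution_unique hg (c := c) h0 h hs.1 hs.2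
  refine ⟨⟨ImpulseControl.leftPoint (D.ratio φ ψ) xl, fun β h1 h2 => V.leftPoint_spec hg ⟨h1, h2⟩,
      (V.excess_tendsto hg).congr fun β => ?_⟩, V.criticalCost_pos hg,
    ImpulseControl.leftBoundary (D.ratio φ ψ) (D.G φ ψ) xl _,
    ImpulseControl.rightBoundary (D.ratio φ ψ) (D.G φ ψ) xl _, ?_, ?_, huniq,
    V.rightBoundary_tendsto_zero hg, V.leftBoundary_tendsto_zero hg,
    V.rightBoundary_tendsto_criticalCost hg, ?_, ?_⟩
  · rw [ImpulseControl.excess, ImpulseControl.Data.bigF, neg_sub]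
  · refine ⟨V.leftBoundary_anti hg, V.rightBoundary_mono hg, fun c hc => V.leftBoundary_mem hg hc,
      fun c hc => (V.rightBoundary_spec hg hc).1, fun c hc x hx => ?_,
      fun c hc => sub_eq_zero.2 (V.ratio_leftBoundary hg hc), fun c hc x hx => ?_,
      fun c hc => ?_⟩
    · have hm := V.leftBoundary_mem hg hc
      rw [← V.ratio_leftBoundary hg hc, sub_pos]
      exact V.anti ⟨hx.1, (hx.2.trans hm.2).le⟩ (Ioo_subset_Ioc_self hm) hx.2
    · have hm := V.leftBoundary_mem hg hc
      rw [sub_neg]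
      rcases le_total x xl with h | h
      · rw [← V.ratio_leftBoundary hg hc]
        exact V.anti (Ioo_subset_Ioc_self hm) ⟨hm.1.trans hx.1, h⟩ hx.1
      · exact V.mono h (h.trans hx.2.le) hx.2
    · have h := (V.rightBoundary_spec hg hc).2
      rw [ImpulseControl.excess] at h
      rw [ImpulseControl.Data.bigF, ImpulseControl.leftBoundary]
      linarith
  · intro γ' β' hfb
    -- Uniqueness of the functions is pointwise: each pair of values solves the free-boundary
    -- system.
    have key : ∀ c ∈ ImpulseControl.Data.costs _, _ := fun c hc =>
      huniq c (γ' c) (β' c) hc.1 (hfb.γ_mem c hc).1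
        ((hfb.γ_mem c hc).2.trans (hfb.β_mem c hc).1)
        ⟨sub_eq_zero.1 (hfb.sign_zero c hc), hfb.cost c hc⟩
    exact ⟨fun c hc => (key c hc).2.1, fun c hc => (key c hc).2.2⟩
  · obtain ⟨l, hl, h1, h2⟩ := V.leftBoundary_tendsto_criticalCost hg
    exact ⟨l, hl, fun h => ⟨V.exceedPoint_eq_top hg h.le, h1 h⟩,
      fun h => ⟨V.exceedPoint_eq_top hg h.ge, h2 h.le⟩,
      fun h => ⟨V.exceedPoint_lt_top hg h, h2 h.le⟩⟩
  · rcases eq_or_ne (ImpulseControl.exceedPoint (D.ratio φ ψ) g₀) ⊤ with h | h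
    · rw [V.criticalCost_lt_top_iff hg (fun x hx => (hD.fundamental.ψ_pos x hx).le) h,
        ← hD.resolvent_bddBelow_iff (EReal.coe_lt_coe_iff.1 hxl.1) hθ]
      simp [h, ImpulseControl.Data.G]
    · have h' := lt_top_iff_ne_top.2 h
      exact ⟨fun _ => Or.inl h', fun _ => V.criticalCost_lt_top hg h'⟩
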